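/- Let $(M,g)$ be a smooth Riemannian surface (in particular, a Riemann surface with a Riemannian metric), let $\pi:P\to M$ be a smooth principal $\mathbb S^1$-bundle with a connection $A$, identify the Lie algebra of $\mathbb S^1$ with $\mathbb R$ by means of a non-zero element $\xi$, and let $\omega\in A^1(P,\mathbb R)$ be the connection $1$-form of $A$ (so $\omega$ is smooth and $\mathbb S^1$-invariant and $\omega(\xi^\#)=1$ for the fundamental vector field $\xi^\#$). Let $f:P\to(0,\infty)$ be a smooth $\mathbb S^1$-invariant function and let $g_A=\pi^*g+f^2\,\omega\otimes\omega$ be the connection metric on $P$, so that $f=\sqrt{g_A(\xi^\#,\xi^\#)}$. Let $(\varphi_1,\varphi_2)$ be a smooth $g$-orthonormal frame over an open set $U\subset M$, $(\eta^1,\eta^2)$ its dual coframe, and $(\eta^i_j)$ the skew-symmetric matrix of smooth $1$-forms on $U$ with $d\eta^i=-\sum_j\eta^i_j\wedge\eta^j$. On $P_U=\pi^{-1}(U)$ let $e_1,e_2$ be the horizontal lifts of $\varphi_1,\varphi_2$, let $e_3=f^{-1}\xi^\#$, and put $\theta^1=\pi^*\eta^1$, $\theta^2=\pi^*\eta^2$,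 $\theta^3=f\omega$. Then $(e_1,e_2,e_3)$ is a $g_A$-orthonormal frame on $P_U$ with dual coframe $(\theta^1,\theta^2,\theta^3)$; there are smooth functions $c,f_1,f_2$ on $P_U$ with $$F_\omega:=d\omega=c\,\theta^1\wedge\theta^2,\qquad df=f_1\theta^1+f_2\theta^2 ;$$ and the Levi-Civita connection $\nabla$ of $g_A$ on $P_U$ is given by $\nabla e_j=\sum_i\theta^i_j\otimes e_i$, where $(\theta^i_j)$ is the skew-symmetric matrix of $1$-forms on $P_U$ with $$\theta^1_2=\pi^*\eta^1_2-\tfrac12 fc\,\theta^3,\qquad \theta^1_3=-\tfrac12 fc\,\theta^2-\tfrac{f_1}{f}\,\theta^3,\qquad \theta^2_3=\tfrac12 fc\,\theta^1-\tfrac{f_2}{f}\,\theta^3 .$$ This is the unique skew-symmetric matrix of smooth $1$-forms on $P_U$ with $d\theta^i=-\sum_j\theta^i_j\wedge\theta^j$. -/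

import Mathlib

open scoped Manifold ContDiff

noncomputable section

/-! ### Differential forms of degree one and their exterior derivative -/

section Forms

variable {E : Type*} [NormedAddCommGroup E] [NormedSpace ℝ E]
  {M : Type*} [TopologicalSpace M] [ChartedSpace E M]
  {F : Type*} [NormedAddCommGroup F] [NormedSpace ℝ F]
  {P : Type*} [TopologicalSpace P] [ChartedSpace F P]

/-- Real-valued `1`-forms on a manifold `M` modelled on `E` (no regularity imposed). -/
abbrev OneForm (E : Type*) [NormedAddCommGroup E] [NormedSpace ℝ E]
    (M : Type*) [TopologicalSpace M] [ChartedSpace E M] : Type _ :=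
  ∀ x : M, TangentSpace 𝓘(ℝ, E) x →L[ℝ] ℝ

/-- Vector fields on a manifold `M` modelled on `E` (no regularity imposed). -/
abbrev VField (E : Type*) [NormedAddCommGroup E] [NormedSpace ℝ E]
    (M : Type*) [TopologicalSpace M] [ChartedSpace E M] : Type _ :=
  ∀ x : M, TangentSpace 𝓘(ℝ, E) x

/-- A vector field is smooth on `U`, as a section of the tangent bundle. -/
def VField.SmoothOn [IsManifold 𝓘(ℝ, E) ∞ M] (X : VField E M) (U : Set M) : Prop :=
  ContMDiffOn 𝓘(ℝ, E) (𝓘(ℝ, E).prod 𝓘(ℝ, E)) ∞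
    (fun x => Bundle.TotalSpace.mk' E (E := fun x : M => TangentSpace 𝓘(ℝ, E) x) x (X x)) U

/-- A `1`-form is smooth on `U`, as a section of the cotangent bundle `Hom(TM, ℝ)`. -/
def OneForm.SmoothOn [IsManifold 𝓘(ℝ, E) ∞ M] (α : OneForm E M) (U : Set M) : Prop :=
  ContMDiffOn 𝓘(ℝ, E) (𝓘(ℝ, E).prod 𝓘(ℝ, E →L[ℝ] ℝ)) ∞
    (fun x => Bundle.TotalSpace.mk' (E →L[ℝ] ℝ)
      (E := fun x : M => TangentSpace 𝓘(ℝ, E) x →L[ℝ] Bundle.Trivial M ℝ x) x (α x)) U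

/-- The exterior derivative `dα` of a `1`-form at `x`, evaluated on two tangent vectors: `α` is
pulled back along the inverse of the chart at `x` to a `1`-form `a` on the model space, and
`da(v, w) = (D_v a)(w) - (D_w a)(v)`. -/
def OneForm.extD (α : OneForm E M) (x : M) (v w : TangentSpace 𝓘(ℝ, E) x) : ℝ :=
  let φ := extChartAt 𝓘(ℝ, E) x
  let a : E → (E →L[ℝ] ℝ) := fun u => (α (φ.symm u)).comp (mfderiv 𝓘(ℝ, E) 𝓘(ℝ, E) φ.symm u)
  let v' : E := mfderiv 𝓘(ℝ, E) 𝓘(ℝ, E) φ x v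
  let w' : E := mfderiv 𝓘(ℝ, E) 𝓘(ℝ, E) φ x w
  fderiv ℝ a (φ x) v' w' - fderiv ℝ a (φ x) w' v'

/-- The wedge product `α ∧ β` of two `1`-forms at `x`, evaluated on two tangent vectors. -/
def OneForm.wedge (α β : OneForm E M) (x : M) (v w : TangentSpace 𝓘(ℝ, E) x) : ℝ :=
  α x v * β x w - α x w * β x v

/-- The pull-back `π^* α` of a `1`-form along `π : P → M`. -/
def OneForm.pullback (π : P → M) (α : OneForm E M) : OneForm F P :=
  fun y => (α (π y)).comp (mfderiv 𝓘(ℝ, F) 𝓘(ℝ, E) π y)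

/-- Given an orthonormal coframe `θ^1, …, θ^n` over an open set `U`, the matrix `Θ` of `1`-forms is
the matrix of Levi-Civita connection forms over `U`: its entries are smooth, it is skew-symmetric,
and `dθ^i = - ∑_j Θ^i_j ∧ θ^j`. Only the values over `U` are relevant. -/
structure IsLeviCivitaMatrix [IsManifold 𝓘(ℝ, E) ∞ M] {n : ℕ} (U : Set M)
    (θ : Fin n → OneForm E M) (Θ : Fin n → Fin n → OneForm E M) : Prop where
  smooth : ∀ i j, (Θ i j).SmoothOn U
  skew : ∀ i j, ∀ x ∈ U, Θ i j x = - Θ j i x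
  structure_eq : ∀ i, ∀ x ∈ U, ∀ v w : TangentSpace 𝓘(ℝ, E) x,
    (θ i).extD x v w = - ∑ j, (Θ i j).wedge (θ j) x v w

/-- `cov` is, over the open set `U`, the Levi-Civita connection of the metric `h`: a covariant
derivative on the tangent bundle which is torsion-free and compatible with `h`.
Here `cov Y x (X x)` is `(∇_X Y)(x)`. -/
structure IsLeviCivitaConnectionOn (h : ∀ x : M, TangentSpace 𝓘(ℝ, E) x →
      TangentSpace 𝓘(ℝ, E) x → ℝ)
    (cov : VField E M → ∀ x : M, TangentSpace 𝓘(ℝ, E) x →L[ℝ] TangentSpace 𝓘(ℝ, E) x)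
    (U : Set M) [IsManifold 𝓘(ℝ, E) ∞ M] : Prop where
  isCovariantDerivativeOn :
    IsCovariantDerivativeOn (I := 𝓘(ℝ, E)) (V := fun x : M => TangentSpace 𝓘(ℝ, E) x) E cov U
  torsion_free : ∀ x ∈ U, ∀ X Y : VField E M,
    MDifferentiableAt 𝓘(ℝ, E) (𝓘(ℝ, E).prod 𝓘(ℝ, E))
      (fun x => Bundle.TotalSpace.mk' E (E := fun x : M => TangentSpace 𝓘(ℝ, E) x) x (X x)) x →
    MDifferentiableAt 𝓘(ℝ, E) (𝓘(ℝ, E).prod 𝓘(ℝ, E))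
      (fun x => Bundle.TotalSpace.mk' E (E := fun x : M => TangentSpace 𝓘(ℝ, E) x) x (Y x)) x →
    cov Y x (X x) - cov X x (Y x) = VectorField.mlieBracket 𝓘(ℝ, E) X Y x
  metric : ∀ x ∈ U, ∀ Y Z : VField E M,
    MDifferentiableAt 𝓘(ℝ, E) (𝓘(ℝ, E).prod 𝓘(ℝ, E))
      (fun x => Bundle.TotalSpace.mk' E (E := fun x : M => TangentSpace 𝓘(ℝ, E) x) x (Y x)) x →
    MDifferentiableAt 𝓘(ℝ, E) (𝓘(ℝ, E).prod 𝓘(ℝ, E))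
      (fun x => Bundle.TotalSpace.mk' E (E := fun x : M => TangentSpace 𝓘(ℝ, E) x) x (Z x)) x →
    ∀ v : TangentSpace 𝓘(ℝ, E) x,
      (mfderiv 𝓘(ℝ, E) 𝓘(ℝ, ℝ) (fun x => h x (Y x) (Z x)) x v : ℝ) =
        h x (cov Y x v) (Z x) + h x (Y x) (cov Z x v)

end Forms

/-! ### Principal circle bundles, connections, and the connection metric -/

section Bundles

variable {E : Type*} [NormedAddCommGroup E] [NormedSpace ℝ E]
  {M : Type*} [TopologicalSpace M] [ChartedSpace E M]
  {F : Type*} [NormedAddCommGroup F] [NormedSpace ℝ F]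
  {P : Type*} [TopologicalSpace P] [ChartedSpace F P] [MulAction Circle P]

/-- `π : P → M` is a smooth principal circle bundle: the circle acts smoothly on `P` along the
fibres of `π`, and `π` is locally isomorphic, equivariantly, to `U × S¹ → U`.
Since the circle is abelian, the right action `y · a` is written `a • y`. -/
structure IsPrincipalCircleBundle (E F : Type*) [NormedAddCommGroup E] [NormedSpace ℝ E]
    [NormedAddCommGroup F] [NormedSpace ℝ F] {M P : Type*} [TopologicalSpace M]
    [ChartedSpace E M] [TopologicalSpace P] [ChartedSpace F P] [MulAction Circle P]
    (π : P → M) : Prop where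
  smooth_proj : ContMDiff 𝓘(ℝ, F) 𝓘(ℝ, E) ∞ π
  smooth_smul : ContMDiff ((𝓡 1).prod 𝓘(ℝ, F)) 𝓘(ℝ, F) ∞ (fun p : Circle × P => p.1 • p.2)
  proj_smul : ∀ (a : Circle) (y : P), π (a • y) = π y
  local_triv : ∀ x : M, ∃ (U : Set M) (Ψ : OpenPartialHomeomorph P (M × Circle)),
    IsOpen U ∧ x ∈ U ∧ Ψ.source = π ⁻¹' U ∧ Ψ.target = U ×ˢ Set.univ ∧
    ContMDiffOn 𝓘(ℝ, F) (𝓘(ℝ, E).prod (𝓡 1)) ∞ Ψ Ψ.source ∧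
    ContMDiffOn (𝓘(ℝ, E).prod (𝓡 1)) 𝓘(ℝ, F) ∞ Ψ.symm Ψ.target ∧
    (∀ y ∈ Ψ.source, (Ψ y).1 = π y) ∧
    (∀ y ∈ Ψ.source, ∀ a : Circle, (Ψ (a • y)).2 = a * (Ψ y).2)

/-- The fundamental vector field `ξ^#_y = d/dt|_{t=0} (y · exp(tξ))` of an element `ξ` of the Lie
algebra of the circle, the latter being identified with `ℝ` through `t ↦ exp(it)`. (The curve passes
through `y` at `t = 0`, so that its velocity is a tangent vector at `y`.) -/
def fundamentalField (ξ : ℝ) : VField F P := fun y =>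
  mfderiv 𝓘(ℝ, ℝ) 𝓘(ℝ, F) (fun t : ℝ => Circle.exp (t * ξ) • y) 0 (1 : ℝ)

/-- `ωA` is the connection `1`-form of a connection on the principal circle bundle `P`, the Lie
algebra being identified with `ℝ` by means of its element `ξ`. The connection itself is the
invariant horizontal distribution `ker ωA`. -/
structure IsConnectionForm [IsManifold 𝓘(ℝ, F) ∞ P] (ξ : ℝ) (ωA : OneForm F P) : Prop where
  smooth : ωA.SmoothOn Set.univ
  vertical : ∀ y : P, ωA y (fundamentalField ξ y) = 1
  invariant : ∀ (a : Circle) (y : P) (v : TangentSpace 𝓘(ℝ, F) y),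
    ωA (a • y) (mfderiv 𝓘(ℝ, F) 𝓘(ℝ, F) (fun z : P => a • z) y v) = ωA y v

/-- The connection metric `g_A = π^* g + f² ωA ⊗ ωA`. -/
def connectionMetric (g : ∀ x : M, TangentSpace 𝓘(ℝ, E) x →L[ℝ] TangentSpace 𝓘(ℝ, E) x →L[ℝ] ℝ)
    (π : P → M) (f : P → ℝ) (ωA : OneForm F P) (y : P) (v w : TangentSpace 𝓘(ℝ, F) y) : ℝ :=
  g (π y) (mfderiv 𝓘(ℝ, F) 𝓘(ℝ, E) π y v) (mfderiv 𝓘(ℝ, F) 𝓘(ℝ, E) π y w)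
    + f y ^ 2 * (ωA y v * ωA y w)

/-- The coframe `(θ^1, θ^2, θ^3) = (π^* η^1, π^* η^2, f ωA)`. -/
def connectionCoframe (π : P → M) (η : Fin 2 → OneForm E M) (f : P → ℝ) (ωA : OneForm F P) :
    Fin 3 → OneForm F P :=
  ![OneForm.pullback π (η 0), OneForm.pullback π (η 1), fun y => f y • ωA y]

end Bundles

end

/-! Skew-symmetry and the structure equations determine connection forms. On a frame, the difference
of two candidates is an array D i j k that is skew in i, j and symmetric in j, k, hence zero. This
argument, `eq_zero_of_skew_of_symm`, serves twice: it gives uniqueness of the matrix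
(`IsLeviCivitaMatrix.unique`) and identifies the matrix with every torsion-free metric connection
(`IsLeviCivitaMatrix.cov_eq`). It remains to check that the proposed forms solve the structure
equations.

For θ¹ and θ² this uses naturality of d (`OneForm.extD_pullback`); for θ³ = fω the Leibniz rule dθ³
= f dω + df ∧ ω (`OneForm.extD_smul`). Both df and dω vanish on vertical vectors: df because f is
invariant, dω by `IsConnectionForm.extD_fundamentalField`. Hence they are combinations of θ¹, θ² and
of θ¹ ∧ θ² respectively. The rest is algebra: the terms in ½fc cancel in the first two equations and
add up to fc in the third. The coefficient c is smooth because it equals -ω([e₁, e₂])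
(`OneForm.extD_eq_neg_apply_mlieBracket`). -/

noncomputable section
-- Smooth 1-forms and their pull-backs
section SmoothForms

open Bundle

variable {E : Type*} [NormedAddCommGroup E] [NormedSpace ℝ E]
  {M : Type*} [TopologicalSpace M] [ChartedSpace E M]
  {F : Type*} [NormedAddCommGroup F] [NormedSpace ℝ F]
  {P : Type*} [TopologicalSpace P] [ChartedSpace F P]
  {V : Type*} [NormedAddCommGroup V] [NormedSpace ℝ V]

/-- A `1`-form is smooth at a point, as a section of the cotangent bundle. -/
def OneForm.SmoothAt [IsManifold 𝓘(ℝ, E) ∞ M] (α : OneForm E M) (x : M) : Prop :=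
  ContMDiffAt 𝓘(ℝ, E) (𝓘(ℝ, E).prod 𝓘(ℝ, E →L[ℝ] ℝ)) ∞
    (fun x => Bundle.TotalSpace.mk' (E →L[ℝ] ℝ)
      (E := fun x : M => TangentSpace 𝓘(ℝ, E) x →L[ℝ] Bundle.Trivial M ℝ x) x (α x)) x

theorem OneForm.smoothOn_iff_smoothAt [IsManifold 𝓘(ℝ, E) ∞ M] {α : OneForm E M} {U : Set M}
    (hU : IsOpen U) : α.SmoothOn U ↔ ∀ x ∈ U, α.SmoothAt x :=
  ⟨fun h x hx => (h x hx).contMDiffAt (hU.mem_nhds hx), fun h x hx => (h x hx).contMDiffWithinAt⟩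

/-- Smoothness of a `1`-form, read in the trivialization of the tangent bundle at the point. -/
theorem OneForm.smoothAt_iff_symmL [IsManifold 𝓘(ℝ, E) ∞ M] {α : OneForm E M} {x₀ : M} :
    α.SmoothAt x₀ ↔ ContMDiffAt 𝓘(ℝ, E) 𝓘(ℝ, E →L[ℝ] ℝ) ∞
      (fun x => (α x).comp
        ((trivializationAt E (TangentSpace 𝓘(ℝ, E) : M → Type _) x₀).symmL ℝ x)) x₀ := by
  rw [OneForm.SmoothAt, contMDiffAt_hom_bundle]
  rw [and_iff_right (show ContMDiffAt 𝓘(ℝ, E) 𝓘(ℝ, E) ∞ (fun x : M => x) x₀ from contMDiffAt_id)]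
  apply Filter.EventuallyEq.contMDiffAt_iff
  refine Filter.Eventually.of_forall fun x => ?_
  ext v
  simp [ContinuousLinearMap.inCoordinates]

/-- A `1`-form on a normed space, as a map to the dual space. -/
def OneForm.toMap (β : OneForm V V) : V → V →L[ℝ] ℝ := fun v => β v

theorem OneForm.smoothAt_iff_contDiffAt {β : OneForm V V} {v₀ : V} :
    β.SmoothAt v₀ ↔ ContDiffAt ℝ ∞ β.toMap v₀ := by
  rw [OneForm.smoothAt_iff_symmL, ← contMDiffAt_iff_contDiffAt]
  apply Filter.EventuallyEq.contMDiffAt_iff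
  refine Filter.Eventually.of_forall fun x => ?_
  ext v
  have := TangentBundle.symmL_model_space (𝕜 := ℝ) v₀ x
  show β x _ = β x v
  congr 1
  exact congrArg (fun L : V →L[ℝ] V => L v) this

/-- In the trivializations at `y₀` and `G y₀`, the pull-back is the coordinate expression of `α`
along `G` composed with the differential of `G` in tangent coordinates. Both factors are smooth, and
the intermediate change of coordinates cancels. -/
theorem OneForm.SmoothAt.pullback [IsManifold 𝓘(ℝ, E) ∞ M] [IsManifold 𝓘(ℝ, F) ∞ P]
    {α : OneForm E M} {G : P → M} {y₀ : P} (hG : ContMDiffAt 𝓘(ℝ, F) 𝓘(ℝ, E) ∞ G y₀)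
    (hα : α.SmoothAt (G y₀)) : (OneForm.pullback G α : OneForm F P).SmoothAt y₀ := by
  rw [OneForm.smoothAt_iff_symmL] at hα ⊢
  have h1 := hα.comp y₀ hG
  have h2 : ContMDiffAt 𝓘(ℝ, F) 𝓘(ℝ, F →L[ℝ] E) ∞ _ y₀ := hG.mfderiv_const (m := ∞) (by simp)
  refine (h1.clm_comp h2).congr_of_eventuallyEq ?_
  have hy : ∀ᶠ y in nhds y₀, y ∈ (chartAt F y₀).source :=
    (chartAt F y₀).open_source.mem_nhds (mem_chart_source F y₀)
  have hGy : ∀ᶠ y in nhds y₀, G y ∈ (chartAt E (G y₀)).source :=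
    hG.continuousAt.eventually ((chartAt E (G y₀)).open_source.mem_nhds (mem_chart_source E _))
  filter_upwards [hy, hGy] with y hy hGy
  rw [inTangentCoordinates_eq_mfderiv_comp (by exact hy) hGy]
  ext v
  rw [← TangentBundle.symmL_trivializationAt (by exact hy),
    ← TangentBundle.continuousLinearMapAt_trivializationAt hGy]
  exact congrArg (α (G y)) (Trivialization.symmL_continuousLinearMapAt
    (trivializationAt E (TangentSpace 𝓘(ℝ, E) : M → Type _) (G y₀)) (by simpa using hGy) _).symm

end SmoothForms
-- Exterior derivative of pull-backs to a normed space
section ExteriorDerivative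

variable {E : Type*} [NormedAddCommGroup E] [NormedSpace ℝ E]
  {M : Type*} [TopologicalSpace M] [ChartedSpace E M]
  {F : Type*} [NormedAddCommGroup F] [NormedSpace ℝ F]
  {P : Type*} [TopologicalSpace P] [ChartedSpace F P]
  {V : Type*} [NormedAddCommGroup V] [NormedSpace ℝ V]

/-- Tangent spaces at distinct points are different types that all unfold to `E`. Reading the vector
in `E` allows transport along equalities such as `φ.symm (φ x) = x`. -/
theorem OneForm.apply_congr_point (α : OneForm E M) {x x' : M} (h : x = x') (u : E) :
    (α x : E →L[ℝ] ℝ) u = (α x' : E →L[ℝ] ℝ) u := by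
  subst h; rfl

theorem OneForm.SmoothAt.toMap_extChartAt_symm [IsManifold 𝓘(ℝ, E) ∞ M] {α : OneForm E M} {x : M}
    (hα : α.SmoothAt x) :
    ContDiffAt ℝ ∞ (OneForm.pullback (extChartAt 𝓘(ℝ, E) x).symm α).toMap
      (extChartAt 𝓘(ℝ, E) x x) := by
  rw [← OneForm.smoothAt_iff_contDiffAt]
  refine OneForm.SmoothAt.pullback ?_ (by simpa using hα)
  exact (contMDiffOn_extChartAt_symm x).contMDiffAt (extChartAt_target_mem_nhds x)

/-- In a neighbourhood of a point, the pull-back along a map `G` from a normed space is expressed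
through the local representation of `G` in the chart at the image of the point. -/
theorem OneForm.toMap_pullback_eventuallyEq [IsManifold 𝓘(ℝ, E) ∞ M] (α : OneForm E M)
    {G : V → M} {v₀ : V} (hG : ContMDiffAt 𝓘(ℝ, V) 𝓘(ℝ, E) ∞ G v₀) :
    (OneForm.pullback G α : OneForm V V).toMap =ᶠ[nhds v₀] fun v =>
      ((OneForm.pullback (extChartAt 𝓘(ℝ, E) (G v₀)).symm α).toMap
        (extChartAt 𝓘(ℝ, E) (G v₀) (G v))).comp
      (fderiv ℝ (fun v => extChartAt 𝓘(ℝ, E) (G v₀) (G v)) v) := by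
  set φ := extChartAt 𝓘(ℝ, E) (G v₀) with hφ
  have hsrc : ∀ᶠ v in nhds v₀, G v ∈ φ.source :=
    hG.continuousAt.eventually (extChartAt_source_mem_nhds (G v₀))
  have hG1 : ∀ᶠ v in nhds v₀, ContMDiffAt 𝓘(ℝ, V) 𝓘(ℝ, E) 1 G v :=
    (contMDiffAt_iff_contMDiffAt_nhds (by simp)).1 (hG.of_le (mod_cast le_top))
  filter_upwards [hsrc.eventually_nhds, hG1] with v hv hG1
  have hvs : G v ∈ φ.source := hv.self_of_nhds
  have hGd : MDifferentiableAt 𝓘(ℝ, V) 𝓘(ℝ, E) G v := hG1.mdifferentiableAt (by simp)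
  have hφd : MDifferentiableAt 𝓘(ℝ, E) 𝓘(ℝ, E) φ (G v) :=
    mdifferentiableAt_extChartAt (by simpa [hφ] using hvs)
  have hφs : MDifferentiableAt 𝓘(ℝ, E) 𝓘(ℝ, E) φ.symm (φ (G v)) :=
    ((contMDiffOn_extChartAt_symm (n := ∞) (G v₀)).contMDiffAt
      ((isOpen_extChartAt_target (G v₀)).mem_nhds (φ.map_source hvs))).mdifferentiableAt (by simp)
  have hp : MDifferentiableAt 𝓘(ℝ, V) 𝓘(ℝ, E) (fun v => φ (G v)) v := hφd.comp v hGd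
  have heq : G =ᶠ[nhds v] fun v => φ.symm (φ (G v)) := by
    filter_upwards [hv] with u hu
    exact (φ.left_inv hu).symm
  have hd : (mfderiv 𝓘(ℝ, V) 𝓘(ℝ, E) G v : V →L[ℝ] E) =
      (mfderiv 𝓘(ℝ, E) 𝓘(ℝ, E) φ.symm (φ (G v)) : E →L[ℝ] E).comp
        (fderiv ℝ (fun v => φ (G v)) v) :=
    ((Filter.EventuallyEq.mfderiv_eq heq).trans (mfderiv_comp v hφs hp)).trans
      (congrArg (fun L : V →L[ℝ] E => (mfderiv 𝓘(ℝ, E) 𝓘(ℝ, E) φ.symm (φ (G v)) : E →L[ℝ] E).comp L)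
        mfderiv_eq_fderiv)
  ext w
  have h2 := congrArg (fun L : V →L[ℝ] E => L w) hd
  exact (congrArg (α (G v) : E →L[ℝ] ℝ) h2).trans
    (OneForm.apply_congr_point α (φ.left_inv hvs).symm _)

/-- Naturality of the exterior derivative, for maps defined on a normed space. -/
theorem OneForm.fderiv_pullback_toMap_sub [IsManifold 𝓘(ℝ, E) ∞ M] {α : OneForm E M}
    {G : V → M} {v₀ : V} (hG : ContMDiffAt 𝓘(ℝ, V) 𝓘(ℝ, E) ∞ G v₀) (hα : α.SmoothAt (G v₀))
    (v w : V) :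
    fderiv ℝ (OneForm.pullback G α : OneForm V V).toMap v₀ v w -
      fderiv ℝ (OneForm.pullback G α : OneForm V V).toMap v₀ w v =
    α.extD (G v₀) (mfderiv 𝓘(ℝ, V) 𝓘(ℝ, E) G v₀ v) (mfderiv 𝓘(ℝ, V) 𝓘(ℝ, E) G v₀ w) := by
  set φ := extChartAt 𝓘(ℝ, E) (G v₀) with hφ
  set a := (OneForm.pullback φ.symm α).toMap with ha
  set p : V → E := fun v => φ (G v) with hp
  have hps : ContDiffAt ℝ ∞ p v₀ := contMDiffAt_iff_contDiffAt.1 (contMDiffAt_extChartAt.comp v₀ hG)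
  have had : HasFDerivAt a (fderiv ℝ a (p v₀)) (p v₀) :=
    (hα.toMap_extChartAt_symm.differentiableAt (by simp)).hasFDerivAt
  have hpd : HasFDerivAt p (fderiv ℝ p v₀) v₀ := (hps.differentiableAt (by simp)).hasFDerivAt
  have hpd2 : HasFDerivAt (fderiv ℝ p) (fderiv ℝ (fderiv ℝ p) v₀) v₀ :=
    ((hps.fderiv_right (m := ∞) (by simp)).differentiableAt (by simp)).hasFDerivAt
  have hsymm : IsSymmSndFDerivAt ℝ p v₀ := hps.isSymmSndFDerivAt (by rw [minSmoothness_of_isRCLikeNormedField]; exact WithTop.coe_le_coe.2 le_top)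
  -- The pulled-back form is (a ∘ p) · Dp. Its derivative has one term in Da and one in D²p; the
  -- latter is symmetric and drops out on antisymmetrizing.
  have hb := (had.comp v₀ hpd).clm_comp hpd2
  have hb' := (hb.congr_of_eventuallyEq (OneForm.toMap_pullback_eventuallyEq α hG)).fderiv
  have hdp : ∀ u : V, (mfderiv 𝓘(ℝ, E) 𝓘(ℝ, E) φ (G v₀)
      (mfderiv 𝓘(ℝ, V) 𝓘(ℝ, E) G v₀ u) : E) = fderiv ℝ p v₀ u := by
    intro u
    exact (congrArg (fun L : V →L[ℝ] E => L u) (mfderiv_comp v₀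
      (mdifferentiableAt_extChartAt (by simp)) (hG.mdifferentiableAt (by simp)))).symm.trans
      (congrArg (fun L : V →L[ℝ] E => L u) mfderiv_eq_fderiv)
  rw [hb']
  show _ = fderiv ℝ a (p v₀) _ _ - fderiv ℝ a (p v₀) _ _
  rw [hdp v, hdp w]
  have := hsymm v w
  simp [this]

end ExteriorDerivative
-- Naturality, Leibniz rule and bracket formula for d
section ExteriorDerivativeRules

variable {E : Type*} [NormedAddCommGroup E] [NormedSpace ℝ E]
  {M : Type*} [TopologicalSpace M] [ChartedSpace E M]
  {F : Type*} [NormedAddCommGroup F] [NormedSpace ℝ F]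
  {P : Type*} [TopologicalSpace P] [ChartedSpace F P]

theorem OneForm.extD_congr_point (α : OneForm E M) {x x' : M} (h : x = x') {u u' w w' : E}
    (hu : u = u') (hw : w = w') : α.extD x u w = α.extD x' u' w' := by
  subst h hu hw; rfl

theorem mfderiv_apply_congr_point (G : P → M) {y y' : P} (h : y = y') (u : F) :
    (mfderiv 𝓘(ℝ, F) 𝓘(ℝ, E) G y : F →L[ℝ] E) u = (mfderiv 𝓘(ℝ, F) 𝓘(ℝ, E) G y' : F →L[ℝ] E) u := by
  subst h; rfl

theorem mfderiv_extChartAt_symm_self_apply [IsManifold 𝓘(ℝ, F) ∞ P] (y : P) (u : F) :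
    (mfderiv 𝓘(ℝ, F) 𝓘(ℝ, F) (extChartAt 𝓘(ℝ, F) y).symm (extChartAt 𝓘(ℝ, F) y y) : F →L[ℝ] F) u
      = u := by
  have h := mfderivWithin_range_extChartAt_symm (I := 𝓘(ℝ, F)) (x := y)
  have hr : Set.range (𝓘(ℝ, F) : F → F) = Set.univ := by simp
  rw [hr, mfderivWithin_univ] at h
  exact congrArg (fun L : F →L[ℝ] F => L u) h

/-- The differential of a chart at its own centre is the identity, so the vectors need no transport
to the model space. -/
theorem OneForm.extD_eq [IsManifold 𝓘(ℝ, E) ∞ M] (α : OneForm E M) (x : M) (v w : E) :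
    α.extD x v w =
      fderiv ℝ (OneForm.pullback (extChartAt 𝓘(ℝ, E) x).symm α).toMap (extChartAt 𝓘(ℝ, E) x x) v w -
      fderiv ℝ (OneForm.pullback (extChartAt 𝓘(ℝ, E) x).symm α).toMap
        (extChartAt 𝓘(ℝ, E) x x) w v := by
  have h : ∀ u : E, (mfderiv 𝓘(ℝ, E) 𝓘(ℝ, E) (extChartAt 𝓘(ℝ, E) x) x : E →L[ℝ] E) u = u :=
    fun u => congrArg (fun L : E →L[ℝ] E => L u) mfderiv_extChartAt_self
  have hv := h v
  have hw := h w
  have h1 : ∀ v' w' : E, v' = v → w' = w →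
    fderiv ℝ (OneForm.pullback (extChartAt 𝓘(ℝ, E) x).symm α).toMap
        (extChartAt 𝓘(ℝ, E) x x) v' w' -
      fderiv ℝ (OneForm.pullback (extChartAt 𝓘(ℝ, E) x).symm α).toMap
        (extChartAt 𝓘(ℝ, E) x x) w' v' = 
    fderiv ℝ (OneForm.pullback (extChartAt 𝓘(ℝ, E) x).symm α).toMap (extChartAt 𝓘(ℝ, E) x x) v w -
      fderiv ℝ (OneForm.pullback (extChartAt 𝓘(ℝ, E) x).symm α).toMap
        (extChartAt 𝓘(ℝ, E) x x) w v := by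
    rintro _ _ rfl rfl; rfl
  exact h1 _ _ hv hw

/-- Naturality of the exterior derivative. -/
theorem OneForm.extD_pullback [IsManifold 𝓘(ℝ, E) ∞ M] [IsManifold 𝓘(ℝ, F) ∞ P]
    {α : OneForm E M} {G : P → M} {y : P} (hG : ContMDiffAt 𝓘(ℝ, F) 𝓘(ℝ, E) ∞ G y)
    (hα : α.SmoothAt (G y)) (v w : F) :
    (OneForm.pullback G α : OneForm F P).extD y v w =
      α.extD (G y) (mfderiv 𝓘(ℝ, F) 𝓘(ℝ, E) G y v) (mfderiv 𝓘(ℝ, F) 𝓘(ℝ, E) G y w) := by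
  set ψ := extChartAt 𝓘(ℝ, F) y with hψ
  have hy : ψ.symm (ψ y) = y := by simp [hψ]
  have hψs : ContMDiffAt 𝓘(ℝ, F) 𝓘(ℝ, F) ∞ ψ.symm (ψ y) :=
    (contMDiffOn_extChartAt_symm y).contMDiffAt (extChartAt_target_mem_nhds y)
  have hG' : ContMDiffAt 𝓘(ℝ, F) 𝓘(ℝ, E) ∞ G (ψ.symm (ψ y)) := by rwa [hy]
  have hH : ContMDiffAt 𝓘(ℝ, F) 𝓘(ℝ, E) ∞ (fun u => G (ψ.symm u)) (ψ y) := hG'.comp (ψ y) hψs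
  have hα' : α.SmoothAt (G (ψ.symm (ψ y))) := by rwa [hy]
  -- Near `ψ y` the chain rule turns the chart expression into a pull-back along `G ∘ ψ.symm`, a map
  -- from a normed space, where naturality is already available.
  have hev : (OneForm.pullback ψ.symm (OneForm.pullback G α : OneForm F P)).toMap =ᶠ[nhds (ψ y)]
      (OneForm.pullback (fun u => G (ψ.symm u)) α : OneForm F F).toMap := by
    have hG1 : ∀ᶠ z in nhds (ψ.symm (ψ y)), ContMDiffAt 𝓘(ℝ, F) 𝓘(ℝ, E) 1 G z :=
      (contMDiffAt_iff_contMDiffAt_nhds (by simp)).1 (hG'.of_le (mod_cast le_top))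
    filter_upwards [hψs.continuousAt.eventually hG1, extChartAt_target_mem_nhds y] with u hu hut
    have hd := mfderiv_comp u (hu.mdifferentiableAt (by simp))
      (((contMDiffOn_extChartAt_symm (n := ∞) y).contMDiffAt
      ((isOpen_extChartAt_target y).mem_nhds hut)).mdifferentiableAt (by simp))
    ext z
    exact congrArg (fun L : F →L[ℝ] E => (α (G (ψ.symm u)) : E →L[ℝ] ℝ) (L z)) hd.symm
  have hd : ∀ u : F, (mfderiv 𝓘(ℝ, F) 𝓘(ℝ, E) (fun u => G (ψ.symm u)) (ψ y) : F →L[ℝ] E) u =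
      (mfderiv 𝓘(ℝ, F) 𝓘(ℝ, E) G y : F →L[ℝ] E) u := by
    intro u
    refine (congrArg (fun L : F →L[ℝ] E => L u) (mfderiv_comp (ψ y)
      (hG'.mdifferentiableAt (by simp)) (hψs.mdifferentiableAt (by simp)))).trans ?_
    refine (congrArg (mfderiv 𝓘(ℝ, F) 𝓘(ℝ, E) G (ψ.symm (ψ y)) : F →L[ℝ] E)
      (mfderiv_extChartAt_symm_self_apply y u)).trans ?_
    exact mfderiv_apply_congr_point G hy u
  rw [OneForm.extD_eq, ← hψ, hev.fderiv_eq, OneForm.fderiv_pullback_toMap_sub hH hα']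
  exact OneForm.extD_congr_point α (congrArg G hy) (hd v) (hd w)

/-- The differential of a function, as a `1`-form. -/
def OneForm.differential (f : P → ℝ) : OneForm F P := fun y => mfderiv 𝓘(ℝ, F) 𝓘(ℝ, ℝ) f y

/-- The Leibniz rule for the exterior derivative. -/
theorem OneForm.extD_smul [IsManifold 𝓘(ℝ, F) ∞ P] {α : OneForm F P} {f : P → ℝ} {y : P}
    (hf : ContMDiffAt 𝓘(ℝ, F) 𝓘(ℝ, ℝ) ∞ f y) (hα : α.SmoothAt y) (v w : F) :
    OneForm.extD (fun y => f y • α y : OneForm F P) y v w =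
      f y * α.extD y v w + (OneForm.differential f : OneForm F P).wedge α y v w := by
  set ψ := extChartAt 𝓘(ℝ, F) y with hψ
  have hy : ψ.symm (ψ y) = y := by simp [hψ]
  have hψs : ContMDiffAt 𝓘(ℝ, F) 𝓘(ℝ, F) ∞ ψ.symm (ψ y) :=
    (contMDiffOn_extChartAt_symm y).contMDiffAt (extChartAt_target_mem_nhds y)
  have hf' : ContMDiffAt 𝓘(ℝ, F) 𝓘(ℝ, ℝ) ∞ f (ψ.symm (ψ y)) := by rwa [hy]
  have hh : ContDiffAt ℝ ∞ (fun u => f (ψ.symm u)) (ψ y) :=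
    contMDiffAt_iff_contDiffAt.1 (hf'.comp (ψ y) hψs)
  have hd : ∀ u : F, fderiv ℝ (fun u => f (ψ.symm u)) (ψ y) u =
      (OneForm.differential f y : F →L[ℝ] ℝ) u := by
    intro u
    refine (congrArg (fun L : F →L[ℝ] ℝ => L u) mfderiv_eq_fderiv.symm).trans ?_
    refine (congrArg (fun L : F →L[ℝ] ℝ => L u) (mfderiv_comp (ψ y)
      (hf'.mdifferentiableAt (by simp)) (hψs.mdifferentiableAt (by simp)))).trans ?_
    refine (congrArg (mfderiv 𝓘(ℝ, F) 𝓘(ℝ, ℝ) f (ψ.symm (ψ y)) : F →L[ℝ] ℝ)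
      (mfderiv_extChartAt_symm_self_apply y u)).trans ?_
    exact mfderiv_apply_congr_point f hy u
  have ha : ∀ u : F, (OneForm.pullback ψ.symm α).toMap (ψ y) u = (α y : F →L[ℝ] ℝ) u := fun u =>
    (congrArg (α (ψ.symm (ψ y)) : F →L[ℝ] ℝ) (mfderiv_extChartAt_symm_self_apply y u)).trans
      (OneForm.apply_congr_point α hy u)
  have heq : (OneForm.pullback ψ.symm (fun y => f y • α y : OneForm F P)).toMap =
      fun u => f (ψ.symm u) • (OneForm.pullback ψ.symm α).toMap u := rfl
  have h1 : OneForm.extD (fun y => f y • α y : OneForm F P) y v w =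
      fderiv ℝ (OneForm.pullback ψ.symm (fun y => f y • α y : OneForm F P)).toMap (ψ y) v w -
      fderiv ℝ (OneForm.pullback ψ.symm (fun y => f y • α y : OneForm F P)).toMap (ψ y) w v :=
    OneForm.extD_eq _ y v w
  have h2 : α.extD y v w = fderiv ℝ (OneForm.pullback ψ.symm α).toMap (ψ y) v w -
      fderiv ℝ (OneForm.pullback ψ.symm α).toMap (ψ y) w v := OneForm.extD_eq _ y v w
  have hA : DifferentiableAt ℝ (OneForm.pullback ψ.symm α).toMap (ψ y) :=
    hα.toMap_extChartAt_symm.differentiableAt (by simp)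
  rw [h1, h2, heq, fderiv_fun_smul (hh.differentiableAt (by simp)) hA]
  simp only [add_apply, smul_apply,
    ContinuousLinearMap.smulRight_apply, smul_eq_mul, hd, ha, hy, OneForm.wedge]
  ring

/-- Exposes the bilinearity that `extD`, a bare function of two vectors, hides; the curvature can
then be expanded in a frame. -/
theorem OneForm.exists_extD_eq_sub [IsManifold 𝓘(ℝ, E) ∞ M] (α : OneForm E M) (x : M) :
    ∃ B : E →L[ℝ] E →L[ℝ] ℝ, ∀ v w : E, α.extD x v w = B v w - B w v :=
  ⟨_, fun v w => α.extD_eq x v w⟩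

/-- The invariant formula for the exterior derivative, on vector fields on which the `1`-form is
locally constant. -/
theorem OneForm.extD_eq_neg_apply_mlieBracket [CompleteSpace E] [IsManifold 𝓘(ℝ, E) ∞ M]
    {α : OneForm E M} {x : M} (hα : α.SmoothAt x) {X Y : VField E M}
    (hX : MDifferentiableAt 𝓘(ℝ, E) (𝓘(ℝ, E).prod 𝓘(ℝ, E))
      (fun x => Bundle.TotalSpace.mk' E (E := fun x : M => TangentSpace 𝓘(ℝ, E) x) x (X x)) x)
    (hY : MDifferentiableAt 𝓘(ℝ, E) (𝓘(ℝ, E).prod 𝓘(ℝ, E))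
      (fun x => Bundle.TotalSpace.mk' E (E := fun x : M => TangentSpace 𝓘(ℝ, E) x) x (Y x)) x)
    {a b : ℝ} (ha : ∀ᶠ z in nhds x, α z (X z) = a) (hb : ∀ᶠ z in nhds x, α z (Y z) = b) :
    α.extD x (X x) (Y x) = - α x (VectorField.mlieBracket 𝓘(ℝ, E) X Y x) := by
  set φ := extChartAt 𝓘(ℝ, E) x with hφ
  have hx : φ.symm (φ x) = x := by simp [hφ]
  have hr : Set.range (𝓘(ℝ, E) : E → E) = Set.univ := by simp
  -- local representation of a vector field in the chart
  set R : VField E M → E → E := fun Z =>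
    VectorField.mpullbackWithin 𝓘(ℝ, E) 𝓘(ℝ, E) φ.symm Z (Set.range 𝓘(ℝ, E)) with hR
  set A := (OneForm.pullback φ.symm α).toMap with hA
  have hAd : DifferentiableAt ℝ A (φ x) := hα.toMap_extChartAt_symm.differentiableAt (by simp)
  have hAx : ∀ u : E, A (φ x) u = (α x : E →L[ℝ] ℝ) u := fun u =>
    (congrArg (α (φ.symm (φ x)) : E →L[ℝ] ℝ) (mfderiv_extChartAt_symm_self_apply x u)).trans
      (OneForm.apply_congr_point α hx u)
  have hRd : ∀ Z : VField E M, MDifferentiableAt 𝓘(ℝ, E) (𝓘(ℝ, E).prod 𝓘(ℝ, E))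
      (fun x => Bundle.TotalSpace.mk' E (E := fun x : M => TangentSpace 𝓘(ℝ, E) x) x (Z x)) x →
      DifferentiableAt ℝ (R Z) (φ x) := by
    intro Z hZ
    have h : DifferentiableWithinAt ℝ (R Z) (φ.symm ⁻¹' Set.univ ∩ Set.range 𝓘(ℝ, E)) (φ x) :=
      MDifferentiableWithinAt.differentiableWithinAt_mpullbackWithin_vectorField (s := Set.univ) (V := Z) (mdifferentiableWithinAt_univ.2 hZ)
    rw [hr, Set.preimage_univ, Set.univ_inter, differentiableWithinAt_univ] at h
    exact h
  have hRx : ∀ Z : VField E M, R Z (φ x) = Z x := by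
    intro Z
    have h1 := mfderivWithin_extChartAt_symm_inverse_apply (I := 𝓘(ℝ, E)) (x := x)
      (Z (φ.symm (φ x)) : E)
    refine h1.trans ?_
    rw [hx]
  have hAR : ∀ (Z : VField E M) (u : E), u ∈ φ.target →
      A u (R Z u) = α (φ.symm u) (Z (φ.symm u)) := by
    intro Z u hu
    have hinv := isInvertible_mfderivWithin_extChartAt_symm (I := 𝓘(ℝ, E)) hu
    have h1 : (mfderivWithin 𝓘(ℝ, E) 𝓘(ℝ, E) φ.symm (Set.range 𝓘(ℝ, E)) u : E →L[ℝ] E) (R Z u) =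
      (Z (φ.symm u) : E) := hinv.self_apply_inverse _
    rw [hr, mfderivWithin_univ] at h1
    exact congrArg (α (φ.symm u) : E →L[ℝ] ℝ) h1
  -- Differentiating the locally constant function A(Z) trades a derivative of the form for a
  -- derivative of the field.
  have hconst : ∀ (Z : VField E M) (k : ℝ), MDifferentiableAt 𝓘(ℝ, E) (𝓘(ℝ, E).prod 𝓘(ℝ, E))
      (fun x => Bundle.TotalSpace.mk' E (E := fun x : M => TangentSpace 𝓘(ℝ, E) x) x (Z x)) x →
      (∀ᶠ z in nhds x, α z (Z z) = k) → ∀ u : E,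
      fderiv ℝ A (φ x) u (R Z (φ x)) + A (φ x) (fderiv ℝ (R Z) (φ x) u) = 0 := by
    intro Z k hZ hk u
    have hev : (fun u => A u (R Z u)) =ᶠ[nhds (φ x)] fun _ => k := by
      have hk' : ∀ᶠ u in nhds (φ x), α (φ.symm u) (Z (φ.symm u)) = k :=
        (continuousAt_extChartAt_symm (I := 𝓘(ℝ, E)) x).eventually
          (p := fun z => α z (Z z) = k) (by rwa [← hφ, hx])
      filter_upwards [hk', extChartAt_target_mem_nhds x] with u hu hut
      rw [hAR Z u hut, hu]
    have h1 := (hAd.hasFDerivAt.clm_apply (hRd Z hZ).hasFDerivAt).fderiv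
    rw [hev.fderiv_eq] at h1
    have h2 := congrArg (fun L : E →L[ℝ] ℝ => L u) h1
    simp only [fderiv_fun_const, Pi.zero_apply, zero_apply,
      add_apply, ContinuousLinearMap.comp_apply,
      ContinuousLinearMap.flip_apply] at h2
    linarith
  have hbr : VectorField.mlieBracket 𝓘(ℝ, E) X Y x =
      fderiv ℝ (R Y) (φ x) (R X (φ x)) - fderiv ℝ (R X) (φ x) (R Y (φ x)) := by
    have h1 (L : E →L[ℝ] E) (hL : L = ContinuousLinearMap.id ℝ E) (S : Set E) (hS : S = Set.univ) :
        L.inverse (VectorField.lieBracketWithin ℝ (R X) (R Y) S (φ x)) =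
          fderiv ℝ (R Y) (φ x) (R X (φ x)) - fderiv ℝ (R X) (φ x) (R Y (φ x)) := by
      subst hL hS
      simp [VectorField.lieBracket_eq]
    exact h1 _ mfderiv_extChartAt_self (φ.symm ⁻¹' Set.univ ∩ Set.range 𝓘(ℝ, E)) (by simp)
  -- Applied to Y along X and to X along Y, this turns DA(X)(Y) - DA(Y)(X) into A(DX·Y - DY·X),
  -- which is -α([X, Y]).
  have hXY := hconst Y b hY hb (R X (φ x))
  have hYX := hconst X a hX ha (R Y (φ x))
  have h3 : α x (VectorField.mlieBracket 𝓘(ℝ, E) X Y x) =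
      A (φ x) (fderiv ℝ (R Y) (φ x) (R X (φ x))) - A (φ x) (fderiv ℝ (R X) (φ x) (R Y (φ x))) :=
    (congrArg (α x : E →L[ℝ] ℝ) hbr).trans ((hAx _).symm.trans (map_sub _ _ _))
  have h4 : α.extD x (X x) (Y x) =
      fderiv ℝ A (φ x) (R X (φ x)) (R Y (φ x)) - fderiv ℝ A (φ x) (R Y (φ x)) (R X (φ x)) := by
    rw [hRx, hRx]
    exact OneForm.extD_eq α x (X x) (Y x)
  rw [h3, h4]
  linarith

end ExteriorDerivativeRules
-- Linear algebra and smoothness of dual frames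
section DualFrames

open Bundle

variable {F : Type*} [NormedAddCommGroup F] [NormedSpace ℝ F]
  {P : Type*} [TopologicalSpace P] [ChartedSpace F P]

/-- Expansion of a vector in a basis, given by a dual family of linear forms. -/
theorem eq_sum_smul_of_dual [FiniteDimensional ℝ F] {n : ℕ} (hF : Module.finrank ℝ F = n) (θ : Fin n → F →L[ℝ] ℝ)
    (e : Fin n → F) (h : ∀ i j, θ i (e j) = if i = j then 1 else 0) (v : F) :
    v = ∑ i, θ i v • e i := by
  have hli : LinearIndependent ℝ e := by
    rw [Fintype.linearIndependent_iff]
    intro g hg i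
    simpa [map_sum, h] using congrArg (θ i) hg
  have hspan : Submodule.span ℝ (Set.range e) = ⊤ :=
    hli.span_eq_top_of_card_eq_finrank' (by simp [hF])
  have hv : v ∈ Submodule.span ℝ (Set.range e) := hspan ▸ Submodule.mem_top
  obtain ⟨c, rfl⟩ := (Submodule.mem_span_range_iff_exists_fun ℝ).1 hv
  simp [map_sum, h]

theorem clm_ext_of_dual [FiniteDimensional ℝ F] {n : ℕ} (hF : Module.finrank ℝ F = n)
    {G : Type*} [NormedAddCommGroup G] [NormedSpace ℝ G] (θ : Fin n → F →L[ℝ] ℝ) (e : Fin n → F)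
    (h : ∀ i j, θ i (e j) = if i = j then 1 else 0) {L L' : F →L[ℝ] G}
    (hL : ∀ k, L (e k) = L' (e k)) : L = L' := by
  ext v
  rw [eq_sum_smul_of_dual hF θ e h v]
  simp [hL]

theorem clm_apply_eq_sum_of_dual [FiniteDimensional ℝ F] {n : ℕ} (hF : Module.finrank ℝ F = n)
    (θ : Fin n → F →L[ℝ] ℝ) (e : Fin n → F) (h : ∀ i j, θ i (e j) = if i = j then 1 else 0)
    {C : F →L[ℝ] F} {T : Fin n → F →L[ℝ] ℝ} (hC : ∀ i k, θ i (C (e k)) = T i (e k)) (v : F) :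
    C v = ∑ i, T i v • e i := by
  have hT : ∀ i, (θ i).comp C = T i := fun i => clm_ext_of_dual hF θ e h (hC i)
  rw [eq_sum_smul_of_dual hF θ e h (C v)]
  exact Finset.sum_congr rfl fun i _ => by rw [← hT i]; rfl

theorem bilin_eq_sum_of_dual [FiniteDimensional ℝ F] {n : ℕ} (hF : Module.finrank ℝ F = n)
    (θ : Fin n → F →L[ℝ] ℝ) (e : Fin n → F) (h : ∀ i j, θ i (e j) = if i = j then 1 else 0)
    {B : F →L[ℝ] F →L[ℝ] ℝ} (hB : ∀ k l, B (e k) (e l) = if k = l then 1 else 0) (v w : F) :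
    B v w = ∑ i, θ i v * θ i w := by
  have h1 : ∀ k, B (e k) = θ k := fun k => clm_ext_of_dual hF θ e h fun l => by rw [hB, h]
  conv_lhs => rw [eq_sum_smul_of_dual hF θ e h v]
  simp [map_sum, h1]

theorem clm_apply_eq_of_dual_three [FiniteDimensional ℝ F] (hF : Module.finrank ℝ F = 3)
    (θ : Fin 3 → F →L[ℝ] ℝ) (e : Fin 3 → F) (h : ∀ i j, θ i (e j) = if i = j then 1 else 0)
    {L : F →L[ℝ] ℝ} (hL : L (e 2) = 0) (v : F) :
    L v = L (e 0) * θ 0 v + L (e 1) * θ 1 v := by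
  conv_lhs => rw [eq_sum_smul_of_dual hF θ e h v]
  simp only [Fin.sum_univ_three, map_add, map_smul, smul_eq_mul, hL]
  ring

/-- `B` is not assumed alternating: the exterior derivative comes as the antisymmetrization of a
bilinear form. Only the pair (0, 1) survives once `e 2` is in the kernel of that antisymmetrization.
-/
theorem alternating_eq_of_dual_three [FiniteDimensional ℝ F] (hF : Module.finrank ℝ F = 3)
    (θ : Fin 3 → F →L[ℝ] ℝ) (e : Fin 3 → F) (h : ∀ i j, θ i (e j) = if i = j then 1 else 0)
    {B : F →L[ℝ] F →L[ℝ] ℝ} (hB : ∀ w, B (e 2) w - B w (e 2) = 0) (v w : F) :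
    B v w - B w v =
      (B (e 0) (e 1) - B (e 1) (e 0)) * (θ 0 v * θ 1 w - θ 0 w * θ 1 v) := by
  conv_lhs => rw [eq_sum_smul_of_dual hF θ e h v, eq_sum_smul_of_dual hF θ e h w]
  simp only [Fin.sum_univ_three, map_add, map_smul, smul_eq_mul, add_apply, smul_apply]
  linear_combination (θ 2 v * θ 0 w - θ 0 v * θ 2 w) * hB (e 0) +
    (θ 2 v * θ 1 w - θ 1 v * θ 2 w) * hB (e 1)

/-- The frame dual to a smooth coframe is smooth. -/
theorem contMDiffAt_of_dual_coframe [IsManifold 𝓘(ℝ, F) ∞ P] {n : ℕ}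
    (hF : Module.finrank ℝ F = n) [FiniteDimensional ℝ F]
    {θ : Fin n → OneForm F P} {e : Fin n → VField F P}
    {y₀ : P} (hθ : ∀ i, (θ i).SmoothAt y₀)
    (h : ∀ᶠ y in nhds y₀, ∀ i j, θ i y (e j y) = if i = j then 1 else 0) (j : Fin n) :
    ContMDiffAt 𝓘(ℝ, F) (𝓘(ℝ, F).prod 𝓘(ℝ, F)) ∞
      (fun x => Bundle.TotalSpace.mk' F (E := fun x : P => TangentSpace 𝓘(ℝ, F) x) x (e j x)) y₀ := by
  set T := trivializationAt F (TangentSpace 𝓘(ℝ, F) : P → Type _) y₀ with hT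
  have : CompleteSpace F := FiniteDimensional.complete ℝ F
  let a : Fin n → P → F →L[ℝ] ℝ := fun i y => (θ i y).comp (T.symmL ℝ y)
  have ha : ∀ i, ContMDiffAt 𝓘(ℝ, F) 𝓘(ℝ, F →L[ℝ] ℝ) ∞ (a i) y₀ := fun i =>
    OneForm.smoothAt_iff_symmL.1 (hθ i)
  -- The whole coframe as one operator in coordinates. It sends the frame to the standard basis, so
  -- `e j` is its inverse applied to a basis vector, and operator inversion is smooth at invertible
  -- operators.
  let A : P → F →L[ℝ] (Fin n → ℝ) := fun y => ContinuousLinearMap.pi fun i => a i y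
  have hA : ContMDiffAt 𝓘(ℝ, F) 𝓘(ℝ, F →L[ℝ] (Fin n → ℝ)) ∞ A y₀ := by
    have hsum : A = fun y => ∑ i, (ContinuousLinearMap.smulRightL ℝ F (Fin n → ℝ)).flip
        (Pi.single i 1) (a i y) := by
      ext y v k
      simp [A, Pi.single_apply]
    rw [hsum]
    have : ∀ i, ContMDiffAt 𝓘(ℝ, F) 𝓘(ℝ, F →L[ℝ] (Fin n → ℝ)) ∞
        (fun y => (ContinuousLinearMap.smulRightL ℝ F (Fin n → ℝ)).flip
        (Pi.single i 1) (a i y)) y₀ := fun i =>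
      (ContinuousLinearMap.contMDiff _).contMDiffAt.comp y₀ (ha i)
    exact ContMDiffAt.sum fun i _ => this i
  let w : P → F := fun y => T.continuousLinearMapAt ℝ y (e j y)
  have hbase : ∀ᶠ y in nhds y₀, y ∈ T.baseSet :=
    T.open_baseSet.mem_nhds (mem_baseSet_trivializationAt F _ y₀)
  have hinv : ∀ᶠ y in nhds y₀, (∃ L : F ≃L[ℝ] (Fin n → ℝ), (L : F →L[ℝ] (Fin n → ℝ)) = A y) ∧
      A y (w y) = Pi.single j 1 := by
    filter_upwards [hbase, h] with y hy h
    have hAe : ∀ k, A y (T.continuousLinearMapAt ℝ y (e k y)) = Pi.single k 1 := by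
      intro k
      ext i
      have h1 := T.symmL_continuousLinearMapAt (R := ℝ) hy (e k y)
      have h2 : θ i y (T.symmL ℝ y (T.continuousLinearMapAt ℝ y (e k y))) =
        if i = k then 1 else 0 := by rw [h1]; exact h i k
      simpa [A, a, Pi.single_apply] using! h2
    refine ⟨?_, hAe j⟩
    -- Surjectivity suffices, since source and target have the same dimension.
    have hsurj : Function.Surjective (A y : F →ₗ[ℝ] (Fin n → ℝ)) := by
      intro c
      refine ⟨∑ k, c k • (T.continuousLinearMapAt ℝ y (e k y) : F), ?_⟩
      rw [map_sum]
      have : ∀ k, (A y : F →ₗ[ℝ] (Fin n → ℝ)) (c k • (T.continuousLinearMapAt ℝ y (e k y) : F)) =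
          c k • Pi.single k 1 := fun k => by rw [map_smul]; exact congrArg (c k • ·) (hAe k)
      rw [Finset.sum_congr rfl fun k _ => this k]
      ext i
      simp [Pi.single_apply]
    have hinj : Function.Injective (A y : F →ₗ[ℝ] (Fin n → ℝ)) :=
      (LinearMap.injective_iff_surjective_of_finrank_eq_finrank (by simp [hF])).2 hsurj
    exact ⟨(LinearEquiv.ofBijective _ ⟨hinj, hsurj⟩).toContinuousLinearEquiv, by ext v; rfl⟩
  rw [contMDiffAt_totalSpace]
  refine ⟨contMDiffAt_id, ?_⟩
  obtain ⟨⟨L, hL⟩, -⟩ := hinv.self_of_nhds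
  have hI : ContMDiffAt 𝓘(ℝ, F) 𝓘(ℝ, (Fin n → ℝ) →L[ℝ] F) ∞ (fun y => (A y).inverse) y₀ := by
    have := contDiffAt_map_inverse (n := ∞) L
    rw [hL] at this
    exact this.contMDiffAt.comp y₀ hA
  refine (hI.clm_apply (contMDiffAt_const (c := (Pi.single j 1 : Fin n → ℝ)))).congr_of_eventuallyEq ?_
  filter_upwards [hinv, hbase] with y hy hyb
  obtain ⟨⟨L, hL⟩, hw⟩ := hy
  have hwy : w y = (A y).inverse (Pi.single j 1) := by
    rw [← hw, ← hL, ContinuousLinearMap.inverse_equiv]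
    simp
  rw [← hwy]
  exact (congrFun (T.coe_linearMapAt_of_mem (R := ℝ) hyb) (e j y)).symm

end DualFrames

/-! ### Orbits of the circle and the vertical part of the curvature -/

section CircleBundles

variable {E : Type*} [NormedAddCommGroup E] [NormedSpace ℝ E]
  {M : Type*} [TopologicalSpace M] [ChartedSpace E M]
  {F : Type*} [NormedAddCommGroup F] [NormedSpace ℝ F]
  {P : Type*} [TopologicalSpace P] [ChartedSpace F P] [MulAction Circle P]
  {E' : Type*} [NormedAddCommGroup E'] [NormedSpace ℝ E']
  {N : Type*} [TopologicalSpace N] [ChartedSpace E' N]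
  {π : P → M} {ξ : ℝ}

theorem IsPrincipalCircleBundle.contMDiff_exp_smul (hπ : IsPrincipalCircleBundle E F π) (y : P) :
    ContMDiff 𝓘(ℝ, ℝ) 𝓘(ℝ, F) ∞ (fun t : ℝ => Circle.exp (t * ξ) • y) := by
  have h1 : ContMDiff 𝓘(ℝ, ℝ) (𝓡 1) ∞ (fun t : ℝ => Circle.exp (t * ξ)) :=
    contMDiff_circleExp.comp (contDiff_id.mul contDiff_const).contMDiff
  exact hπ.smooth_smul.comp (h1.prodMk contMDiff_const)

/-- Orbits come from a one-parameter group: shifting time by `t` turns the orbit of `y` into that of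
`z`, whose velocity at 0 defines the fundamental field. -/
theorem IsPrincipalCircleBundle.mfderiv_exp_smul (hπ : IsPrincipalCircleBundle E F π) (y : P)
    (t : ℝ) : (mfderiv 𝓘(ℝ, ℝ) 𝓘(ℝ, F) (fun t : ℝ => Circle.exp (t * ξ) • y) t : ℝ →L[ℝ] F) 1 =
      (fundamentalField ξ (Circle.exp (t * ξ) • y) : F) := by
  set z := Circle.exp (t * ξ) • y with hz
  have heq : (fun s : ℝ => Circle.exp (s * ξ) • y) =
      (fun s : ℝ => Circle.exp (s * ξ) • z) ∘ (fun s : ℝ => s - t) := by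
    ext s
    simp only [Function.comp_apply, hz, smul_smul, ← Circle.exp_add]
    ring_nf
  have hs : ContMDiff 𝓘(ℝ, ℝ) 𝓘(ℝ, ℝ) ∞ (fun s : ℝ => s - t) :=
    (contDiff_id.sub contDiff_const).contMDiff
  have hd : (mfderiv 𝓘(ℝ, ℝ) 𝓘(ℝ, ℝ) (fun s : ℝ => s - t) t : ℝ →L[ℝ] ℝ) 1 = 1 := by
    have h : HasFDerivAt (fun s : ℝ => s - t) (ContinuousLinearMap.id ℝ ℝ) t :=
      (hasFDerivAt_id t).sub_const t
    exact congrArg (fun L : ℝ →L[ℝ] ℝ => L 1) h.hasMFDerivAt.mfderiv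
  rw [heq]
  refine (congrArg (fun L : ℝ →L[ℝ] F => L 1) (mfderiv_comp (f := fun s : ℝ => s - t) t
    ((hπ.contMDiff_exp_smul (ξ := ξ) z).mdifferentiable (by simp) (t - t))
    (hs.mdifferentiable (by simp) t))).trans ?_
  refine (congrArg (mfderiv 𝓘(ℝ, ℝ) 𝓘(ℝ, F) (fun s : ℝ => Circle.exp (s * ξ) • z) (t - t) :
    ℝ →L[ℝ] F) hd).trans ?_
  exact mfderiv_apply_congr_point _ (sub_self t) 1

/-- The differential of an invariant map vanishes on the fundamental field. -/
theorem IsPrincipalCircleBundle.mfderiv_fundamentalField (hπ : IsPrincipalCircleBundle E F π)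
    {H : P → N} {y : P} (hH : MDifferentiableAt 𝓘(ℝ, F) 𝓘(ℝ, E') H y)
    (hinv : ∀ (a : Circle), H (a • y) = H y) :
    (mfderiv 𝓘(ℝ, F) 𝓘(ℝ, E') H y : F →L[ℝ] E') (fundamentalField ξ y) = 0 := by
  set c : ℝ → P := fun t => Circle.exp (t * ξ) • y with hc
  have hc0 : c 0 = y := by simp [hc]
  have hH0 : MDifferentiableAt 𝓘(ℝ, F) 𝓘(ℝ, E') H (c 0) := by rwa [hc0]
  have hHc : H ∘ c = fun _ => H y := funext fun t => hinv _
  have h1 := mfderiv_comp (0 : ℝ) hH0 ((hπ.contMDiff_exp_smul (ξ := ξ) y).mdifferentiable (by simp) 0)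
  have h2 := congrArg (fun L : ℝ →L[ℝ] E' => L 1) h1
  have h3 : (mfderiv 𝓘(ℝ, ℝ) 𝓘(ℝ, E') (H ∘ c) 0 : ℝ →L[ℝ] E') 1 = 0 := by
    rw [hHc]
    exact congrArg (fun L : ℝ →L[ℝ] E' => L 1) mfderiv_const
  exact (mfderiv_apply_congr_point H hc0 _).symm.trans (h2.symm.trans h3)

/-- The contraction of the curvature with the fundamental field vanishes. -/
theorem IsConnectionForm.extD_fundamentalField [IsManifold 𝓘(ℝ, F) ∞ P]
    (hπ : IsPrincipalCircleBundle E F π) {ωA : OneForm F P} (hωA : IsConnectionForm ξ ωA)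
    (y : P) (w : F) : ωA.extD y (fundamentalField ξ y) w = 0 := by
  set ψ := extChartAt 𝓘(ℝ, F) y with hψ
  -- Flowing a chart along the circle action gives G^*ω = dt + A, where A, the form ω in the chart,
  -- does not depend on t. Hence ∂_t contracts d(G^*ω) to zero, and naturality carries this to `P`.
  set G : ℝ × F → P := fun p => Circle.exp (p.1 * ξ) • ψ.symm p.2 with hG
  have hψs : ∀ u ∈ ψ.target, ContMDiffAt 𝓘(ℝ, F) 𝓘(ℝ, F) ∞ ψ.symm u := fun u hu =>
    (contMDiffOn_extChartAt_symm y).contMDiffAt ((isOpen_extChartAt_target y).mem_nhds hu)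
  have hGs : ∀ p : ℝ × F, p.2 ∈ ψ.target → ContMDiffAt 𝓘(ℝ, ℝ × F) 𝓘(ℝ, F) ∞ G p := by
    intro p hp
    have h1 : ContMDiffAt 𝓘(ℝ, ℝ × F) (𝓡 1) ∞ (fun p : ℝ × F => Circle.exp (p.1 * ξ)) p :=
      contMDiff_circleExp.contMDiffAt.comp p
        (contDiff_fst.mul contDiff_const).contMDiff.contMDiffAt
    have h2 : ContMDiffAt 𝓘(ℝ, ℝ × F) 𝓘(ℝ, F) ∞ (fun p : ℝ × F => ψ.symm p.2) p :=
      (hψs p.2 hp).comp p contDiff_snd.contMDiff.contMDiffAt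
    exact hπ.smooth_smul.contMDiffAt.comp p (h1.prodMk h2)
  -- partial derivatives of `G`
  have hGt : ∀ p : ℝ × F, p.2 ∈ ψ.target →
      (mfderiv 𝓘(ℝ, ℝ × F) 𝓘(ℝ, F) G p : ℝ × F →L[ℝ] F) (1, 0) = (fundamentalField ξ (G p) : F) := by
    rintro ⟨t, u⟩ hp
    have hl : HasFDerivAt (fun s : ℝ => (s, u)) (ContinuousLinearMap.inl ℝ ℝ F) t :=
      hasFDerivAt_prodMk_left t u
    have h1 := mfderiv_comp t ((hGs (t, u) hp).mdifferentiableAt (by simp))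
      hl.hasMFDerivAt.mdifferentiableAt
    have h2 := hl.hasMFDerivAt.mfderiv
    have h3 := hπ.mfderiv_exp_smul (ξ := ξ) (ψ.symm u) t
    refine Eq.trans ?_ h3
    refine Eq.trans ?_ (congrArg (fun L : ℝ →L[ℝ] F => L 1) h1).symm
    refine congrArg (mfderiv 𝓘(ℝ, ℝ × F) 𝓘(ℝ, F) G (t, u) : ℝ × F →L[ℝ] F) ?_
    exact (congrArg (fun L : ℝ →L[ℝ] ℝ × F => L 1) h2).symm
  have hGr : ∀ p : ℝ × F, p.2 ∈ ψ.target → ∀ z : F,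
      (mfderiv 𝓘(ℝ, ℝ × F) 𝓘(ℝ, F) G p : ℝ × F →L[ℝ] F) (0, z) =
        (mfderiv 𝓘(ℝ, F) 𝓘(ℝ, F) (fun u => G (p.1, u)) p.2 : F →L[ℝ] F) z := by
    rintro ⟨t, u⟩ hp z
    have hr : HasFDerivAt (fun x : F => (t, x)) (ContinuousLinearMap.inr ℝ ℝ F) u :=
      hasFDerivAt_prodMk_right t u
    have h1 := mfderiv_comp u ((hGs (t, u) hp).mdifferentiableAt (by simp))
      hr.hasMFDerivAt.mdifferentiableAt
    refine Eq.trans ?_ (congrArg (fun L : F →L[ℝ] F => L z) h1).symm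
    refine congrArg (mfderiv 𝓘(ℝ, ℝ × F) 𝓘(ℝ, F) G (t, u) : ℝ × F →L[ℝ] F) ?_
    exact (congrArg (fun L : F →L[ℝ] ℝ × F => L z) hr.hasMFDerivAt.mfderiv).symm
  have hGu : ∀ p : ℝ × F, p.2 ∈ ψ.target → ∀ z : F,
      (ωA (G p) : F →L[ℝ] ℝ) ((mfderiv 𝓘(ℝ, ℝ × F) 𝓘(ℝ, F) G p : ℝ × F →L[ℝ] F) (0, z)) =
        (OneForm.pullback ψ.symm ωA).toMap p.2 z := by
    rintro ⟨t, u⟩ hp z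
    have hact : ContMDiff 𝓘(ℝ, F) 𝓘(ℝ, F) ∞ (fun x : P => Circle.exp (t * ξ) • x) :=
      hπ.smooth_smul.comp (contMDiff_const.prodMk contMDiff_id)
    have h3 := mfderiv_comp u (hact.mdifferentiable (by simp) (ψ.symm u))
      ((hψs u hp).mdifferentiableAt (by simp))
    refine Eq.trans (congrArg (ωA (G (t, u)) : F →L[ℝ] ℝ) ?_)
      (hωA.invariant (Circle.exp (t * ξ)) (ψ.symm u)
        ((mfderiv 𝓘(ℝ, F) 𝓘(ℝ, F) ψ.symm u : F →L[ℝ] F) z))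
    exact (hGr (t, u) hp z).trans (congrArg (fun L : F →L[ℝ] F => L z) h3)
  set A := (OneForm.pullback ψ.symm ωA).toMap with hA
  have hω : ωA.SmoothAt y := (OneForm.smoothOn_iff_smoothAt isOpen_univ).1 hωA.smooth y trivial
  have hAd : DifferentiableAt ℝ A (ψ y) := hω.toMap_extChartAt_symm.differentiableAt (by simp)
  -- The summand dt comes from ω(ξ^#) = 1, the other from invariance of ω.
  have hev : (OneForm.pullback G ωA : OneForm (ℝ × F) (ℝ × F)).toMap =ᶠ[nhds ((0 : ℝ), ψ y)]
      fun p => ContinuousLinearMap.fst ℝ ℝ F + (A p.2).comp (ContinuousLinearMap.snd ℝ ℝ F) := by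
    have ht : ∀ᶠ p in nhds ((0 : ℝ), ψ y), p.2 ∈ ψ.target :=
      continuousAt_snd.eventually (p := fun u => u ∈ ψ.target)
        ((isOpen_extChartAt_target y).mem_nhds (mem_extChartAt_target y))
    filter_upwards [ht] with p hp
    refine ContinuousLinearMap.ext fun q => ?_
    have hq : q = q.1 • ((1 : ℝ), (0 : F)) + ((0 : ℝ), q.2) := by ext <;> simp
    have h1 : (OneForm.pullback G ωA : OneForm (ℝ × F) (ℝ × F)).toMap p (1, 0) = 1 :=
      (congrArg (ωA (G p) : F →L[ℝ] ℝ) (hGt p hp)).trans (hωA.vertical (G p))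
    have h2 : (OneForm.pullback G ωA : OneForm (ℝ × F) (ℝ × F)).toMap p (0, q.2) = A p.2 q.2 :=
      hGu p hp q.2
    conv_lhs => rw [hq, map_add, map_smul, h1, h2]
    simp
  have hy : ψ.symm (ψ y) = y := by simp [hψ]
  have hG0 : G (0, ψ y) = y := by simp [hG, hy]
  have hyt : ψ y ∈ ψ.target := mem_extChartAt_target y
  have hderiv : HasFDerivAt (fun p : ℝ × F =>
      ContinuousLinearMap.fst ℝ ℝ F + (A p.2).comp (ContinuousLinearMap.snd ℝ ℝ F))
      (((ContinuousLinearMap.compL ℝ (ℝ × F) F ℝ).flip (ContinuousLinearMap.snd ℝ ℝ F)).comp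
        ((fderiv ℝ A (ψ y)).comp (ContinuousLinearMap.snd ℝ ℝ F))) ((0 : ℝ), ψ y) := by
    have h1 : HasFDerivAt (fun p : ℝ × F => A p.2)
        ((fderiv ℝ A (ψ y)).comp (ContinuousLinearMap.snd ℝ ℝ F)) ((0 : ℝ), ψ y) :=
      HasFDerivAt.comp (g := A) ((0 : ℝ), ψ y) hAd.hasFDerivAt hasFDerivAt_snd
    exact ((((ContinuousLinearMap.compL ℝ (ℝ × F) F ℝ).flip
      (ContinuousLinearMap.snd ℝ ℝ F)).hasFDerivAt).comp ((0 : ℝ), ψ y) h1).const_add _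
  have hcore := OneForm.fderiv_pullback_toMap_sub (hGs (0, ψ y) hyt)
    (α := ωA) (by rwa [hG0]) (1, 0) (0, w)
  rw [hev.fderiv_eq, hderiv.fderiv] at hcore
  have hgw : (mfderiv 𝓘(ℝ, ℝ × F) 𝓘(ℝ, F) G (0, ψ y) : ℝ × F →L[ℝ] F) (0, w) = w := by
    have h0 : (fun u => G (0, u)) = ψ.symm := by ext u; simp [hG]
    refine (hGr (0, ψ y) hyt w).trans ?_
    exact (congrArg (fun H : F → P => (mfderiv 𝓘(ℝ, F) 𝓘(ℝ, F) H (ψ y) : F →L[ℝ] F) w) h0).trans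
      (mfderiv_extChartAt_symm_self_apply y w)
  refine (OneForm.extD_congr_point ωA hG0 ?_ hgw).symm.trans (hcore.symm.trans (by simp))
  refine (hGt (0, ψ y) hyt).trans ?_
  rw [hG0]

end CircleBundles
-- Operations preserving smoothness
section SmoothFormOperations

open Bundle

variable {F : Type*} [NormedAddCommGroup F] [NormedSpace ℝ F]
  {P : Type*} [TopologicalSpace P] [ChartedSpace F P] [IsManifold 𝓘(ℝ, F) ∞ P]
  {α β : OneForm F P} {y : P}

theorem OneForm.SmoothAt.congr (hα : α.SmoothAt y) (h : ∀ᶠ z in nhds y, β z = α z) :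
    β.SmoothAt y := by
  refine ContMDiffAt.congr_of_eventuallyEq hα ?_
  filter_upwards [h] with z hz
  rw [hz]

theorem OneForm.SmoothAt.sub (hα : α.SmoothAt y) (hβ : β.SmoothAt y) :
    (α - β : OneForm F P).SmoothAt y := by
  rw [OneForm.smoothAt_iff_symmL] at *
  exact hα.sub hβ

theorem OneForm.SmoothAt.neg (hα : α.SmoothAt y) : (-α : OneForm F P).SmoothAt y := by
  rw [OneForm.smoothAt_iff_symmL] at *
  exact hα.neg

theorem OneForm.smoothAt_zero : (0 : OneForm F P).SmoothAt y := by
  rw [OneForm.smoothAt_iff_symmL]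
  exact contMDiffAt_const (c := (0 : F →L[ℝ] ℝ))

theorem OneForm.SmoothAt.smul {f : P → ℝ} (hf : ContMDiffAt 𝓘(ℝ, F) 𝓘(ℝ, ℝ) ∞ f y)
    (hα : α.SmoothAt y) : OneForm.SmoothAt (fun z => f z • α z : OneForm F P) y := by
  rw [OneForm.smoothAt_iff_symmL] at *
  exact hf.smul hα

theorem OneForm.SmoothAt.apply {X : VField F P} (hα : α.SmoothAt y)
    (hX : ContMDiffAt 𝓘(ℝ, F) (𝓘(ℝ, F).prod 𝓘(ℝ, F)) ∞
      (fun x => Bundle.TotalSpace.mk' F (E := fun x : P => TangentSpace 𝓘(ℝ, F) x) x (X x)) y) :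
    ContMDiffAt 𝓘(ℝ, F) 𝓘(ℝ, ℝ) ∞ (fun z => α z (X z)) y :=
  (contMDiffAt_totalSpace.1 (ContMDiffAt.clm_bundle_apply hα hX)).2

/-- The tangent map of `f` composed with the section `X` is smooth; its fibre component is df(X),
because the trivialization of the tangent bundle of ℝ is the identity. -/
theorem contMDiffAt_mfderiv_apply {f : P → ℝ} (hf : ContMDiff 𝓘(ℝ, F) 𝓘(ℝ, ℝ) ∞ f) {X : VField F P}
    (hX : ContMDiffAt 𝓘(ℝ, F) (𝓘(ℝ, F).prod 𝓘(ℝ, F)) ∞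
      (fun x => Bundle.TotalSpace.mk' F (E := fun x : P => TangentSpace 𝓘(ℝ, F) x) x (X x)) y) :
    ContMDiffAt 𝓘(ℝ, F) 𝓘(ℝ, ℝ) ∞ (fun z => (OneForm.differential f z) (X z)) y := by
  have h := (hf.contMDiff_tangentMap (m := ∞) (by simp)).contMDiffAt.comp y hX
  refine (contMDiffAt_totalSpace.1 h).2.congr_of_eventuallyEq
    (Filter.Eventually.of_forall fun z => ?_)
  exact (congrArg (fun L : ℝ →L[ℝ] ℝ => L (OneForm.differential f z (X z)))
    (TangentBundle.continuousLinearMapAt_model_space (𝕜 := ℝ) (f y) (f z))).symm.trans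
      (congrFun (Trivialization.coe_linearMapAt_of_mem (R := ℝ)
        (trivializationAt ℝ (TangentSpace 𝓘(ℝ, ℝ)) (f y)) (Set.mem_univ _)) _)

/-- The exterior derivative of a smooth form on two smooth fields on which the form is locally
constant is smooth. -/
theorem OneForm.SmoothAt.extD_apply [CompleteSpace F] {U : Set P} (hU : IsOpen U)
    (hα : ∀ z ∈ U, α.SmoothAt z) {X Y : VField F P}
    (hX : ∀ z ∈ U, ContMDiffAt 𝓘(ℝ, F) (𝓘(ℝ, F).prod 𝓘(ℝ, F)) ∞
      (fun x => Bundle.TotalSpace.mk' F (E := fun x : P => TangentSpace 𝓘(ℝ, F) x) x (X x)) z)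
    (hY : ∀ z ∈ U, ContMDiffAt 𝓘(ℝ, F) (𝓘(ℝ, F).prod 𝓘(ℝ, F)) ∞
      (fun x => Bundle.TotalSpace.mk' F (E := fun x : P => TangentSpace 𝓘(ℝ, F) x) x (Y x)) z)
    {a b : ℝ} (ha : ∀ z ∈ U, α z (X z) = a) (hb : ∀ z ∈ U, α z (Y z) = b) (hy : y ∈ U) :
    ContMDiffAt 𝓘(ℝ, F) 𝓘(ℝ, ℝ) ∞ (fun z => α.extD z (X z) (Y z)) y := by
  have hbr : ContMDiffAt 𝓘(ℝ, F) (𝓘(ℝ, F).prod 𝓘(ℝ, F)) ∞ (fun x => Bundle.TotalSpace.mk' F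
      (E := fun x : P => TangentSpace 𝓘(ℝ, F) x) x (VectorField.mlieBracket 𝓘(ℝ, F) X Y x)) y := by
    have h1 : IsManifold 𝓘(ℝ, F) (((⊤ : ℕ∞) : WithTop ℕ∞) + 1) P := ‹IsManifold 𝓘(ℝ, F) ∞ P›
    have h2 : IsManifold 𝓘(ℝ, F) (minSmoothness ℝ 2) P := by
      rw [minSmoothness_of_isRCLikeNormedField]; infer_instance
    exact ContMDiffAt.mlieBracket_vectorField (m := ⊤) (n := ⊤) (hX y hy) (hY y hy)
      (by rw [minSmoothness_of_isRCLikeNormedField]; exact le_rfl)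
  -- Near `y` the function is -α([X, Y]), and the bracket of smooth fields is smooth.
  refine ((hα y hy).apply hbr).neg.congr_of_eventuallyEq ?_
  filter_upwards [hU.mem_nhds hy] with z hz
  refine OneForm.extD_eq_neg_apply_mlieBracket (hα z hz) ((hX z hz).mdifferentiableAt (by simp))
    ((hY z hz).mdifferentiableAt (by simp)) (a := a) (b := b) ?_ ?_
  · filter_upwards [hU.mem_nhds hz] with u hu using ha u hu
  · filter_upwards [hU.mem_nhds hz] with u hu using hb u hu

end SmoothFormOperations

/-! ### Uniqueness of the connection forms -/

section LeviCivita

variable {F : Type*} [NormedAddCommGroup F] [NormedSpace ℝ F]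
  {P : Type*} [TopologicalSpace P] [ChartedSpace F P]

/-- An array that is skew-symmetric in the first two and symmetric in the last two indices
vanishes. -/
theorem eq_zero_of_skew_of_symm {ι : Type*} {D : ι → ι → ι → ℝ} (hskew : ∀ i j k, D i j k = -D j i k)
    (hsymm : ∀ i j k, D i j k = D i k j) (i j k : ι) : D i j k = 0 := by
  -- Alternating the two symmetries, three times each, returns to the original indices with sign -1.
  linarith [hskew i j k, hsymm j i k, hskew j k i, hsymm k j i, hskew k i j, hsymm i k j]

variable [IsManifold 𝓘(ℝ, F) ∞ P] {n : ℕ} {W : Set P}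
  {θ : Fin n → OneForm F P} {e : Fin n → VField F P} {Θ Θ' : Fin n → Fin n → OneForm F P}

/-- The left side does not involve `Θ`, so the difference of two solutions is symmetric in its last
two indices. -/
theorem IsLeviCivitaMatrix.extD_frame (hΘ : IsLeviCivitaMatrix W θ Θ) {y : P} (hy : y ∈ W)
    (hdual : ∀ i j, θ i y (e j y) = if i = j then 1 else 0) (i k l : Fin n) :
    (θ i).extD y (e k y) (e l y) = Θ i k y (e l y) - Θ i l y (e k y) := by
  rw [hΘ.structure_eq i y hy]
  simp [OneForm.wedge, hdual, Finset.sum_sub_distrib]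

variable [FiniteDimensional ℝ F]

/-- Uniqueness of the matrix of Levi-Civita connection forms. -/
theorem IsLeviCivitaMatrix.unique (hF : Module.finrank ℝ F = n) (hΘ : IsLeviCivitaMatrix W θ Θ)
    (hΘ' : IsLeviCivitaMatrix W θ Θ') {y : P} (hy : y ∈ W)
    (hdual : ∀ i j, θ i y (e j y) = if i = j then 1 else 0) (i j : Fin n) :
    Θ' i j y = Θ i j y := by
  have hD : ∀ i j k, (Θ' i j y (e k y) - Θ i j y (e k y) : ℝ) = 0 := by
    refine eq_zero_of_skew_of_symm (D := fun i j k => (Θ' i j y (e k y) - Θ i j y (e k y) : ℝ)) ?_ ?_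
    · intro i j k
      rw [hΘ'.skew i j y hy, hΘ.skew i j y hy]
      simp
      ring
    · intro i j k
      have h1 := hΘ.extD_frame hy hdual i j k
      have h2 := hΘ'.extD_frame hy hdual i j k
      linarith
  exact clm_ext_of_dual hF (fun i => (θ i y : F →L[ℝ] ℝ)) (fun j => e j y) hdual
    fun k => sub_eq_zero.1 (hD i j k)

/-- The Levi-Civita connection of a metric in an orthonormal frame is given by the matrix of
Levi-Civita connection forms of the dual coframe. -/
theorem IsLeviCivitaMatrix.cov_eq (hF : Module.finrank ℝ F = n) (hW : IsOpen W)
    (hΘ : IsLeviCivitaMatrix W θ Θ) (hθ : ∀ i, ∀ y ∈ W, (θ i).SmoothAt y)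
    (hdual : ∀ i j, ∀ y ∈ W, θ i y (e j y) = if i = j then 1 else 0)
    {h : ∀ x : P, TangentSpace 𝓘(ℝ, F) x → TangentSpace 𝓘(ℝ, F) x → ℝ}
    (hh : ∀ y ∈ W, ∀ v w, h y v w = ∑ i, θ i y v * θ i y w)
    {cov : VField F P → ∀ y : P, TangentSpace 𝓘(ℝ, F) y →L[ℝ] TangentSpace 𝓘(ℝ, F) y}
    (hcov : IsLeviCivitaConnectionOn h cov W) (j : Fin n) {y : P} (hy : y ∈ W) (v : F) :
    cov (e j) y v = ∑ i, Θ i j y v • e i y := by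
  have hcomplete : CompleteSpace F := FiniteDimensional.complete ℝ F
  have hWy := hW.mem_nhds hy
  have he : ∀ j, MDifferentiableAt 𝓘(ℝ, F) (𝓘(ℝ, F).prod 𝓘(ℝ, F))
      (fun x => Bundle.TotalSpace.mk' F (E := fun x : P => TangentSpace 𝓘(ℝ, F) x) x (e j x)) y :=
    fun j => (contMDiffAt_of_dual_coframe hF (fun i => hθ i y hy)
      (by filter_upwards [hWy] with z hz i j using hdual i j z hz) j).mdifferentiableAt (by simp)
  -- Skewness comes from metric compatibility, as the products h(e_i, e_j) are constant. Symmetry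
  -- comes from torsion-freeness and dθ^i(e_k, e_j) = -θ^i([e_k, e_j]).
  have hD : ∀ i j k, (θ i y (cov (e j) y (e k y)) - Θ i j y (e k y) : ℝ) = 0 := by
    refine eq_zero_of_skew_of_symm
      (D := fun i j k => (θ i y (cov (e j) y (e k y)) - Θ i j y (e k y) : ℝ)) ?_ ?_
    · intro i j k
      have h1 := hcov.metric y hy (e i) (e j) (he i) (he j) (e k y)
      have h2 : (fun x => h x (e i x) (e j x)) =ᶠ[nhds y] fun _ => if i = j then 1 else 0 := by
        filter_upwards [hWy] with z hz
        rw [hh z hz]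
        simp [hdual _ _ z hz, eq_comm]
      have h3 : (mfderiv 𝓘(ℝ, F) 𝓘(ℝ, ℝ) (fun x => h x (e i x) (e j x)) y : F →L[ℝ] ℝ) (e k y) = 0 :=
        congrArg (fun L : F →L[ℝ] ℝ => L (e k y)) (h2.mfderiv_eq.trans mfderiv_const)
      have h4 := h3.symm.trans h1
      have h6 : h y (cov (e i) y (e k y)) (e j y) = θ j y (cov (e i) y (e k y)) := by
        simp [hh y hy, hdual _ _ y hy]
      have h7 : h y (e i y) (cov (e j) y (e k y)) = θ i y (cov (e j) y (e k y)) := by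
        simp [hh y hy, hdual _ _ y hy]
      have h8 : (0 : ℝ) = θ j y (cov (e i) y (e k y)) + θ i y (cov (e j) y (e k y)) := by
        rw [← h6, ← h7]; exact h4
      have h5 : (Θ i j y (e k y) : ℝ) = -Θ j i y (e k y) := by rw [hΘ.skew i j y hy]; rfl
      have h9 : ∀ a b c d : ℝ, 0 = c + a → b = -d → a - b = -(c - d) := by
        intros; linarith
      exact h9 _ _ _ _ h8 h5
    · intro i j k
      have h1 := hcov.torsion_free y hy (e k) (e j) (he k) (he j)
      have h2 := OneForm.extD_eq_neg_apply_mlieBracket (hθ i y hy) (he k) (he j)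
        (a := if i = k then 1 else 0) (b := if i = j then 1 else 0)
        (by filter_upwards [hWy] with z hz using hdual i k z hz)
        (by filter_upwards [hWy] with z hz using hdual i j z hz)
      have h3 := hΘ.extD_frame hy (fun i j => hdual i j y hy) i k j
      rw [← h1, map_sub] at h2
      linarith
  exact clm_apply_eq_sum_of_dual hF (fun i => (θ i y : F →L[ℝ] ℝ)) (fun j => e j y)
    (fun i j => hdual i j y hy) (T := fun i => Θ i j y) (fun i k => sub_eq_zero.1 (hD i j k)) v

end LeviCivita

/-! ### Smoothness of the orthonormal coframe on the base -/

section ConnectionMetrics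

open Bundle

variable {E : Type*} [NormedAddCommGroup E] [NormedSpace ℝ E]
  {M : Type*} [TopologicalSpace M] [ChartedSpace E M] [IsManifold 𝓘(ℝ, E) ∞ M]

/-- The coframe dual to a smooth orthonormal frame is smooth. -/
theorem smoothAt_of_dual_orthonormal_frame [FiniteDimensional ℝ E] {n : ℕ}
    (hE : Module.finrank ℝ E = n)
    (g : Bundle.ContMDiffRiemannianMetric 𝓘(ℝ, E) ∞ E (fun x : M => TangentSpace 𝓘(ℝ, E) x))
    {U : Set M} (hU : IsOpen U) {φ : Fin n → VField E M} (hφ : ∀ i, (φ i).SmoothOn U)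
    (hφ_orth : ∀ i j, ∀ x ∈ U, g.inner x (φ i x) (φ j x) = if i = j then 1 else 0)
    {η : Fin n → OneForm E M} (hη : ∀ i j, ∀ x ∈ U, η i x (φ j x) = if i = j then 1 else 0)
    (i : Fin n) {x : M} (hx : x ∈ U) : (η i).SmoothAt x := by
  have h1 : ContMDiffAt 𝓘(ℝ, E) (𝓘(ℝ, E).prod 𝓘(ℝ, E →L[ℝ] ℝ)) ∞
      (fun x => Bundle.TotalSpace.mk' (E →L[ℝ] ℝ)
        (E := fun x : M => TangentSpace 𝓘(ℝ, E) x →L[ℝ] Bundle.Trivial M ℝ x) x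
        (g.inner x (φ i x))) x :=
    ContMDiffAt.clm_bundle_apply (g.contMDiff x) ((hφ i x hx).contMDiffAt (hU.mem_nhds hx))
  refine OneForm.SmoothAt.congr (α := fun x => g.inner x (φ i x)) h1 ?_
  filter_upwards [hU.mem_nhds hx] with z hz
  -- Both η^i and g(φ_i, ·) take the values δ_ij on the frame.
  exact clm_ext_of_dual hE (fun i => (η i z : E →L[ℝ] ℝ)) (fun j => φ j z)
    (fun i j => hη i j z hz) fun k => (hη i k z hz).trans (hφ_orth i k z hz).symm

end ConnectionMetrics

end

/-! ### The connection metric -/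

theorem proposition1
    -- the surface `M` with its Riemannian metric `g`, and the total space `P`
    {E : Type*} [NormedAddCommGroup E] [NormedSpace ℝ E] (hE : Module.finrank ℝ E = 2)
    {M : Type*} [TopologicalSpace M] [ChartedSpace E M] [IsManifold 𝓘(ℝ, E) ∞ M]
    {F : Type*} [NormedAddCommGroup F] [NormedSpace ℝ F] (hF : Module.finrank ℝ F = 3)
    {P : Type*} [TopologicalSpace P] [ChartedSpace F P] [IsManifold 𝓘(ℝ, F) ∞ P]
    [MulAction Circle P]
    (g : Bundle.ContMDiffRiemannianMetric 𝓘(ℝ, E) ∞ E (fun x : M => TangentSpace 𝓘(ℝ, E) x))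
    -- the principal bundle, the connection form and the length `f` of the fundamental field
    (π : P → M) (hπ : IsPrincipalCircleBundle E F π)
    (ξ : ℝ) (hξ : ξ ≠ 0) (ωA : OneForm F P) (hωA : IsConnectionForm ξ ωA)
    (f : P → ℝ) (hf : ContMDiff 𝓘(ℝ, F) 𝓘(ℝ, ℝ) ∞ f) (hf_pos : ∀ y, 0 < f y)
    (hf_inv : ∀ (a : Circle) (y : P), f (a • y) = f y)
    -- the local orthonormal frame `φ`, its dual coframe `η`, and the Levi-Civita forms of `g`
    (U : Set M) (hU : IsOpen U)
    (φ : Fin 2 → VField E M) (hφ : ∀ i, (φ i).SmoothOn U)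
    (hφ_orth : ∀ i j, ∀ x ∈ U, g.inner x (φ i x) (φ j x) = if i = j then 1 else 0)
    (η : Fin 2 → OneForm E M) (hη : ∀ i j, ∀ x ∈ U, η i x (φ j x) = if i = j then 1 else 0)
    (ηc : Fin 2 → Fin 2 → OneForm E M) (hηc : IsLeviCivitaMatrix U η ηc)
    -- the frame `e`: the horizontal lifts of `φ` and the normalized fundamental field
    (e : Fin 3 → VField F P)
    (he_hor : ∀ y ∈ π ⁻¹' U, ωA y (e 0 y) = 0 ∧ ωA y (e 1 y) = 0)
    (he_lift : ∀ y ∈ π ⁻¹' U, mfderiv 𝓘(ℝ, F) 𝓘(ℝ, E) π y (e 0 y) = φ 0 (π y) ∧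
      mfderiv 𝓘(ℝ, F) 𝓘(ℝ, E) π y (e 1 y) = φ 1 (π y))
    (he_vert : ∀ y ∈ π ⁻¹' U, e 2 y = (f y)⁻¹ • fundamentalField ξ y)
    -- the coframe `θ`
    (θ : Fin 3 → OneForm F P) (hθ : θ = connectionCoframe π η f ωA) :
    -- `e` is orthonormal for the connection metric, and `θ` is its dual coframe
    (∀ i j, ∀ y ∈ π ⁻¹' U,
      connectionMetric g.inner π f ωA y (e i y) (e j y) = (if i = j then 1 else 0) ∧
      θ i y (e j y) = if i = j then 1 else 0) ∧
    -- the functions `c`, `f₁`, `f₂` exist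
    (∃ c f₁ f₂ : P → ℝ,
      ContMDiffOn 𝓘(ℝ, F) 𝓘(ℝ, ℝ) ∞ c (π ⁻¹' U) ∧
      ContMDiffOn 𝓘(ℝ, F) 𝓘(ℝ, ℝ) ∞ f₁ (π ⁻¹' U) ∧
      ContMDiffOn 𝓘(ℝ, F) 𝓘(ℝ, ℝ) ∞ f₂ (π ⁻¹' U) ∧
      (∀ y ∈ π ⁻¹' U, ∀ v w : TangentSpace 𝓘(ℝ, F) y,
        ωA.extD y v w = c y * (θ 0).wedge (θ 1) y v w) ∧
      (∀ y ∈ π ⁻¹' U, ∀ v : TangentSpace 𝓘(ℝ, F) y,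
        (mfderiv 𝓘(ℝ, F) 𝓘(ℝ, ℝ) f y v : ℝ) = f₁ y * θ 0 y v + f₂ y * θ 1 y v)) ∧
    -- and with them the Levi-Civita connection is given by the formulas
    (∀ c f₁ f₂ : P → ℝ,
      (∀ y ∈ π ⁻¹' U, ∀ v w : TangentSpace 𝓘(ℝ, F) y,
        ωA.extD y v w = c y * (θ 0).wedge (θ 1) y v w) →
      (∀ y ∈ π ⁻¹' U, ∀ v : TangentSpace 𝓘(ℝ, F) y,
        (mfderiv 𝓘(ℝ, F) 𝓘(ℝ, ℝ) f y v : ℝ) = f₁ y * θ 0 y v + f₂ y * θ 1 y v) →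
      ∃ Θ : Fin 3 → Fin 3 → OneForm F P,
        -- `Θ` is the unique skew-symmetric solution of the structure equations
        IsLeviCivitaMatrix (π ⁻¹' U) θ Θ ∧
        (∀ Θ' : Fin 3 → Fin 3 → OneForm F P, IsLeviCivitaMatrix (π ⁻¹' U) θ Θ' →
          ∀ i j, ∀ y ∈ π ⁻¹' U, Θ' i j y = Θ i j y) ∧
        -- `Θ` is the matrix of the Levi-Civita connection of `g_A` in the frame `e`
        (∀ cov : VField F P → ∀ y : P, TangentSpace 𝓘(ℝ, F) y →L[ℝ] TangentSpace 𝓘(ℝ, F) y,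
          IsLeviCivitaConnectionOn (connectionMetric g.inner π f ωA) cov (π ⁻¹' U) →
          ∀ j, ∀ y ∈ π ⁻¹' U, ∀ v : TangentSpace 𝓘(ℝ, F) y,
            cov (e j) y v = ∑ i, Θ i j y v • e i y) ∧
        -- the formulas
        ∀ y ∈ π ⁻¹' U,
          Θ 0 1 y = OneForm.pullback π (ηc 0 1) y - (f y * c y / 2) • θ 2 y ∧
          Θ 0 2 y = - (f y * c y / 2) • θ 1 y - (f₁ y / f y) • θ 2 y ∧
          Θ 1 2 y = (f y * c y / 2) • θ 0 y - (f₂ y / f y) • θ 2 y) := by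
  subst hθ
  have hEfin : FiniteDimensional ℝ E := FiniteDimensional.of_finrank_pos (by omega)
  have hFfin : FiniteDimensional ℝ F := FiniteDimensional.of_finrank_pos (by omega)
  have hFc : CompleteSpace F := FiniteDimensional.complete ℝ F
  set θ := connectionCoframe π η f ωA
  have hW : IsOpen (π ⁻¹' U) := hU.preimage hπ.smooth_proj.continuous
  have hπs : ∀ y, ContMDiffAt 𝓘(ℝ, F) 𝓘(ℝ, E) ∞ π y := fun y => hπ.smooth_proj.contMDiffAt
  have hfs : ∀ y, ContMDiffAt 𝓘(ℝ, F) 𝓘(ℝ, ℝ) ∞ f y := fun y => hf.contMDiffAt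
  have hπξ : ∀ y, (mfderiv 𝓘(ℝ, F) 𝓘(ℝ, E) π y : F →L[ℝ] E) (fundamentalField ξ y) = 0 := fun y =>
    hπ.mfderiv_fundamentalField ((hπs y).mdifferentiableAt (by simp)) fun a => hπ.proj_smul a y
  have hfξ : ∀ y, (OneForm.differential f y : F →L[ℝ] ℝ) (fundamentalField ξ y) = 0 := fun y =>
    hπ.mfderiv_fundamentalField ((hfs y).mdifferentiableAt (by simp)) fun a => hf_inv a y
  have hηs : ∀ i, ∀ x ∈ U, (η i).SmoothAt x := fun i x hx =>
    smoothAt_of_dual_orthonormal_frame hE g hU hφ hφ_orth hη i hx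
  have hωs : ∀ y, ωA.SmoothAt y := fun y =>
    (OneForm.smoothOn_iff_smoothAt isOpen_univ).1 hωA.smooth y trivial
  have hθ2 : ∀ y (v : F), (θ 2 y : F →L[ℝ] ℝ) v = f y * (ωA y : F →L[ℝ] ℝ) v := fun _ _ => rfl
  have hθs : ∀ i, ∀ y ∈ π ⁻¹' U, (θ i).SmoothAt y := by
    intro i y hy
    fin_cases i
    · exact OneForm.SmoothAt.pullback (hπs y) (hηs 0 _ hy)
    · exact OneForm.SmoothAt.pullback (hπs y) (hηs 1 _ hy)
    · exact OneForm.SmoothAt.smul (hfs y) (hωs y)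
  have hdual : ∀ i j, ∀ y ∈ π ⁻¹' U, θ i y (e j y) = if i = j then 1 else 0 := by
    intro i j y hy
    have hv : (e 2 y : F) = (f y)⁻¹ • (fundamentalField ξ y : F) := he_vert y hy
    have hπ2 : (mfderiv 𝓘(ℝ, F) 𝓘(ℝ, E) π y : F →L[ℝ] E) (e 2 y) = 0 := by
      rw [hv, map_smul, hπξ, smul_zero]
    have hω2 : f y * (ωA y : F →L[ℝ] ℝ) (e 2 y) = 1 := by
      have h1 : (ωA y : F →L[ℝ] ℝ) (fundamentalField ξ y) = 1 := hωA.vertical y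
      rw [hv, map_smul, h1, smul_eq_mul, mul_one]
      exact mul_inv_cancel₀ (hf_pos y).ne'
    have h0 := (he_lift y hy).1
    have h1 := (he_lift y hy).2
    have hh0 : (ωA y : F →L[ℝ] ℝ) (e 0 y) = 0 := (he_hor y hy).1
    have hh1 : (ωA y : F →L[ℝ] ℝ) (e 1 y) = 0 := (he_hor y hy).2
    fin_cases i <;> fin_cases j
    · exact (congrArg (η 0 (π y)) h0).trans (hη 0 0 _ hy)
    · exact (congrArg (η 0 (π y)) h1).trans (hη 0 1 _ hy)
    · exact (congrArg (η 0 (π y)) hπ2).trans (map_zero _)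
    · exact (congrArg (η 1 (π y)) h0).trans (hη 1 0 _ hy)
    · exact (congrArg (η 1 (π y)) h1).trans (hη 1 1 _ hy)
    · exact (congrArg (η 1 (π y)) hπ2).trans (map_zero _)
    · exact (hθ2 y (e 0 y)).trans (by rw [hh0, mul_zero]; simp)
    · exact (hθ2 y (e 1 y)).trans (by rw [hh1, mul_zero]; simp)
    · exact (hθ2 y (e 2 y)).trans hω2
  have hmetric : ∀ y ∈ π ⁻¹' U, ∀ v w : TangentSpace 𝓘(ℝ, F) y,
      connectionMetric g.inner π f ωA y v w = ∑ i, θ i y v * θ i y w := by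
    intro y hy v w
    have hgU : ∀ a b : E, (g.inner (π y) : E →L[ℝ] E →L[ℝ] ℝ) a b =
        ∑ i, (η i (π y) : E →L[ℝ] ℝ) a * (η i (π y) : E →L[ℝ] ℝ) b := by
      exact bilin_eq_sum_of_dual hE (fun i => (η i (π y) : E →L[ℝ] ℝ)) (fun j => φ j (π y))
        (fun i j => hη i j _ hy) fun k l => hφ_orth k l _ hy
    have h2 := hgU ((mfderiv 𝓘(ℝ, F) 𝓘(ℝ, E) π y : F →L[ℝ] E) v)
      ((mfderiv 𝓘(ℝ, F) 𝓘(ℝ, E) π y : F →L[ℝ] E) w)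
    rw [Fin.sum_univ_two] at h2
    rw [Fin.sum_univ_three]
    have hθv := hθ2 y v
    have hθw := hθ2 y w
    rw [connectionMetric]
    refine (congrArg (fun r : ℝ => r + f y ^ 2 * (ωA y v * ωA y w)) h2).trans ?_
    refine congrArg₂ (fun r s : ℝ => r + s) rfl ?_
    refine Eq.trans ?_ (congrArg₂ (fun r s : ℝ => r * s) hθv hθw).symm
    show f y ^ 2 * ((ωA y : F →L[ℝ] ℝ) v * (ωA y : F →L[ℝ] ℝ) w) =
      f y * (ωA y : F →L[ℝ] ℝ) v * (f y * (ωA y : F →L[ℝ] ℝ) w)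
    ring
  -- Smoothness of the horizontal lifts is not assumed; it follows from that of the dual coframe.
  have hes : ∀ j, ∀ y ∈ π ⁻¹' U, ContMDiffAt 𝓘(ℝ, F) (𝓘(ℝ, F).prod 𝓘(ℝ, F)) ∞
      (fun x => Bundle.TotalSpace.mk' F (E := fun x : P => TangentSpace 𝓘(ℝ, F) x) x (e j x)) y :=
    fun j y hy => contMDiffAt_of_dual_coframe hF (fun i => hθs i y hy)
      (by filter_upwards [hW.mem_nhds hy] with z hz i j using hdual i j z hz) j
  -- the coefficients of `dω` and `df`
  let c₀ : P → ℝ := fun y => ωA.extD y (e 0 y) (e 1 y)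
  let h₁ : P → ℝ := fun y => (OneForm.differential f y : F →L[ℝ] ℝ) (e 0 y)
  let h₂ : P → ℝ := fun y => (OneForm.differential f y : F →L[ℝ] ℝ) (e 1 y)
  -- Since ω vanishes on `e 0` and `e 1`, the bracket formula applies with both constants 0.
  have hc₀s : ∀ y ∈ π ⁻¹' U, ContMDiffAt 𝓘(ℝ, F) 𝓘(ℝ, ℝ) ∞ c₀ y := fun y hy =>
    OneForm.SmoothAt.extD_apply hW (fun z _ => hωs z) (hes 0) (hes 1)
      (fun z hz => (he_hor z hz).1) (fun z hz => (he_hor z hz).2) hy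
  have hh₁s : ∀ y ∈ π ⁻¹' U, ContMDiffAt 𝓘(ℝ, F) 𝓘(ℝ, ℝ) ∞ h₁ y := fun y hy =>
    contMDiffAt_mfderiv_apply hf (hes 0 y hy)
  have hh₂s : ∀ y ∈ π ⁻¹' U, ContMDiffAt 𝓘(ℝ, F) 𝓘(ℝ, ℝ) ∞ h₂ y := fun y hy =>
    contMDiffAt_mfderiv_apply hf (hes 1 y hy)
  have hcurv : ∀ y ∈ π ⁻¹' U, ∀ v w : TangentSpace 𝓘(ℝ, F) y,
      ωA.extD y v w = c₀ y * (θ 0).wedge (θ 1) y v w := by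
    intro y hy v w
    obtain ⟨Q, hQ⟩ := ωA.exists_extD_eq_sub y
    have hQ2 : ∀ u : F, Q (e 2 y) u - Q u (e 2 y) = 0 := by
      intro u
      have hv : (e 2 y : F) = (f y)⁻¹ • (fundamentalField ξ y : F) := he_vert y hy
      have hQξ : Q (fundamentalField ξ y : F) u - Q u (fundamentalField ξ y : F) = 0 :=
        (hQ _ _).symm.trans (hωA.extD_fundamentalField hπ y u)
      have key : ∀ (x z : F) (r : ℝ), x = r • z → Q z u - Q u z = 0 → Q x u - Q u x = 0 := by
        rintro _ z r rfl h
        rw [map_smul, map_smul, smul_apply, ← smul_sub, h, smul_zero]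
      exact key _ _ _ hv hQξ
    refine (hQ v w).trans ?_
    refine (alternating_eq_of_dual_three hF (fun i => (θ i y : F →L[ℝ] ℝ)) (fun j => e j y)
      (fun i j => hdual i j y hy) hQ2 v w).trans ?_
    exact congrArg (fun r : ℝ => r * (θ 0).wedge (θ 1) y v w) (hQ (e 0 y) (e 1 y)).symm
  have hdf : ∀ y ∈ π ⁻¹' U, ∀ v : TangentSpace 𝓘(ℝ, F) y,
      (mfderiv 𝓘(ℝ, F) 𝓘(ℝ, ℝ) f y v : ℝ) = h₁ y * θ 0 y v + h₂ y * θ 1 y v := by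
    intro y hy v
    have hv : (e 2 y : F) = (f y)⁻¹ • (fundamentalField ξ y : F) := he_vert y hy
    have key : ∀ (L : F →L[ℝ] ℝ) (x z : F) (r : ℝ), x = r • z → L z = 0 → L x = 0 := by
      rintro L _ z r rfl h
      rw [map_smul, h, smul_zero]
    exact clm_apply_eq_of_dual_three hF (fun i => (θ i y : F →L[ℝ] ℝ)) (fun j => e j y)
      (fun i j => hdual i j y hy) (L := OneForm.differential f y)
      (key (OneForm.differential f y) _ _ _ hv (hfξ y)) v
  refine ⟨fun i j y hy => ⟨?_, hdual i j y hy⟩, ⟨c₀, h₁, h₂, fun y hy => (hc₀s y hy).contMDiffWithinAt,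
    fun y hy => (hh₁s y hy).contMDiffWithinAt, fun y hy => (hh₂s y hy).contMDiffWithinAt,
    hcurv, hdf⟩, ?_⟩
  · rw [hmetric y hy]
    simp [hdual _ _ y hy, eq_comm]
  intro c f₁ f₂ hc hf12
  -- The given coefficients carry no smoothness assumption; evaluation on the frame identifies them
  -- over π⁻¹(U) with the smooth ones already constructed.
  have hc_eq : ∀ y ∈ π ⁻¹' U, c y = c₀ y := by
    intro y hy
    have h := hc y hy (e 0 y) (e 1 y)
    simp [OneForm.wedge, hdual _ _ y hy] at h
    exact h.symm
  have hf₁_eq : ∀ y ∈ π ⁻¹' U, f₁ y = h₁ y := by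
    intro y hy
    have h := hf12 y hy (e 0 y)
    simp [hdual _ _ y hy] at h
    exact h.symm
  have hf₂_eq : ∀ y ∈ π ⁻¹' U, f₂ y = h₂ y := by
    intro y hy
    have h := hf12 y hy (e 1 y)
    simp [hdual _ _ y hy] at h
    exact h.symm
  have hcs : ∀ y ∈ π ⁻¹' U, ContMDiffAt 𝓘(ℝ, F) 𝓘(ℝ, ℝ) ∞ c y := fun y hy =>
    (hc₀s y hy).congr_of_eventuallyEq (by filter_upwards [hW.mem_nhds hy] with z hz using hc_eq z hz)
  have hf₁s : ∀ y ∈ π ⁻¹' U, ContMDiffAt 𝓘(ℝ, F) 𝓘(ℝ, ℝ) ∞ f₁ y := fun y hy =>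
    (hh₁s y hy).congr_of_eventuallyEq (by filter_upwards [hW.mem_nhds hy] with z hz using hf₁_eq z hz)
  have hf₂s : ∀ y ∈ π ⁻¹' U, ContMDiffAt 𝓘(ℝ, F) 𝓘(ℝ, ℝ) ∞ f₂ y := fun y hy =>
    (hh₂s y hy).congr_of_eventuallyEq (by filter_upwards [hW.mem_nhds hy] with z hz using hf₂_eq z hz)
  let k : P → ℝ := fun y => f y * c y / 2
  let r₁ : P → ℝ := fun y => f₁ y / f y
  let r₂ : P → ℝ := fun y => f₂ y / f y
  have hks : ∀ y ∈ π ⁻¹' U, ContMDiffAt 𝓘(ℝ, F) 𝓘(ℝ, ℝ) ∞ k y := fun y hy =>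
    ((hfs y).mul (hcs y hy)).div_const 2
  have hr₁s : ∀ y ∈ π ⁻¹' U, ContMDiffAt 𝓘(ℝ, F) 𝓘(ℝ, ℝ) ∞ r₁ y := fun y hy =>
    (hf₁s y hy).div₀ (hfs y) (hf_pos y).ne'
  have hr₂s : ∀ y ∈ π ⁻¹' U, ContMDiffAt 𝓘(ℝ, F) 𝓘(ℝ, ℝ) ∞ r₂ y := fun y hy =>
    (hf₂s y hy).div₀ (hfs y) (hf_pos y).ne'
  let A : OneForm F P := OneForm.pullback π (ηc 0 1) - (fun y => k y • θ 2 y : OneForm F P)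
  let B : OneForm F P := -(fun y => k y • θ 1 y : OneForm F P) - (fun y => r₁ y • θ 2 y : OneForm F P)
  let C : OneForm F P := (fun y => k y • θ 0 y : OneForm F P) - (fun y => r₂ y • θ 2 y : OneForm F P)
  have hηcs : ∀ x ∈ U, (ηc 0 1).SmoothAt x :=
    (OneForm.smoothOn_iff_smoothAt hU).1 (hηc.smooth 0 1)
  have hAs : ∀ y ∈ π ⁻¹' U, A.SmoothAt y := fun y hy =>
    (OneForm.SmoothAt.pullback (hπs y) (hηcs _ hy)).sub ((hθs 2 y hy).smul (hks y hy))
  have hBs : ∀ y ∈ π ⁻¹' U, B.SmoothAt y := fun y hy =>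
    ((hθs 1 y hy).smul (hks y hy)).neg.sub ((hθs 2 y hy).smul (hr₁s y hy))
  have hCs : ∀ y ∈ π ⁻¹' U, C.SmoothAt y := fun y hy =>
    ((hθs 0 y hy).smul (hks y hy)).sub ((hθs 2 y hy).smul (hr₂s y hy))
  let Θ : Fin 3 → Fin 3 → OneForm F P := ![![0, A, B], ![-A, 0, C], ![-B, -C, 0]]
  have hΘ : IsLeviCivitaMatrix (π ⁻¹' U) θ Θ := by
    refine ⟨fun i j => (OneForm.smoothOn_iff_smoothAt hW).2 fun y hy => ?_, fun i j y hy => ?_,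
      fun i y hy v w => ?_⟩
    · fin_cases i <;> fin_cases j
      exacts [OneForm.smoothAt_zero, hAs y hy, hBs y hy, (hAs y hy).neg, OneForm.smoothAt_zero,
        hCs y hy, (hBs y hy).neg, (hCs y hy).neg, OneForm.smoothAt_zero]
    · fin_cases i <;> fin_cases j
      exacts [neg_zero.symm, (neg_neg (A y)).symm, (neg_neg (B y)).symm, rfl, neg_zero.symm,
        (neg_neg (C y)).symm, rfl, rfl, neg_zero.symm]
    · let T : Fin 3 → F → ℝ := fun i => (θ i y : F →L[ℝ] ℝ)
      let p : F → ℝ := fun u => (OneForm.pullback π (ηc 0 1) y : F →L[ℝ] ℝ) u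
      have hηc0 : ∀ i (u : E), (ηc i i (π y) : E →L[ℝ] ℝ) u = 0 := fun i u =>
        self_eq_neg.1 (congrArg (fun L : E →L[ℝ] ℝ => L u) (hηc.skew i i (π y) hy))
      have hηc1 : ∀ u : E, (ηc 1 0 (π y) : E →L[ℝ] ℝ) u = -(ηc 0 1 (π y) : E →L[ℝ] ℝ) u :=
        fun u => congrArg (fun L : E →L[ℝ] ℝ => L u) (hηc.skew 1 0 (π y) hy)
      let D : F →L[ℝ] E := mfderiv 𝓘(ℝ, F) 𝓘(ℝ, E) π y
      fin_cases i
      -- The extra terms -k θ³ ∧ θ² and -k θ² ∧ θ³ cancel and θ³ ∧ θ³ = 0, leaving the pulled-back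
      -- structure equation. `key` states the identity over plain reals, away from the tangent space
      -- types.
      · have h1 := OneForm.extD_pullback (hπs y) (hηs 0 _ hy) v w
        have h2 := h1.trans (hηc.structure_eq 0 _ hy _ _)
        refine h2.trans ?_
        simp only [Fin.sum_univ_two, Fin.sum_univ_three, OneForm.wedge]
        have key : ∀ a b z₀ z₁ z₂ w₀ w₁ w₂ pv pw kk rr : ℝ, a = 0 → b = 0 →
            -((a * w₀ - b * z₀) + (pv * w₁ - pw * z₁)) =
              -((0 * w₀ - 0 * z₀) + ((pv - kk * z₂) * w₁ - (pw - kk * w₂) * z₁) +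
                ((-(kk * z₁) - rr * z₂) * w₂ - (-(kk * w₁) - rr * w₂) * z₂)) := by
          intros
          subst_vars
          ring
        exact key _ _ (T 0 v) (T 1 v) (T 2 v) (T 0 w) (T 1 w) (T 2 w) (p v) (p w) (k y) (r₁ y)
          (hηc0 0 (D v)) (hηc0 0 (D w))
      · have h1 := OneForm.extD_pullback (hπs y) (hηs 1 _ hy) v w
        have h2 := h1.trans (hηc.structure_eq 1 _ hy _ _)
        refine h2.trans ?_
        simp only [Fin.sum_univ_two, Fin.sum_univ_three, OneForm.wedge]
        have key : ∀ a b m n z₀ z₁ z₂ w₀ w₁ w₂ pv pw kk rr : ℝ, a = 0 → b = 0 → m = -pv → n = -pw →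
            -((m * w₀ - n * z₀) + (a * w₁ - b * z₁)) =
              -((-(pv - kk * z₂) * w₀ - -(pw - kk * w₂) * z₀) + (0 * w₁ - 0 * z₁) +
                ((kk * z₀ - rr * z₂) * w₂ - (kk * w₀ - rr * w₂) * z₂)) := by
          intros
          subst_vars
          ring
        exact key _ _ _ _ (T 0 v) (T 1 v) (T 2 v) (T 0 w) (T 1 w) (T 2 w) (p v) (p w) (k y) (r₂ y)
          (hηc0 1 (D v)) (hηc0 1 (D w)) (hηc1 (D v)) (hηc1 (D w))
      -- The forms `B` and `C` each contribute half of fc θ¹ ∧ θ², which is f dω; their θ³-terms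
      -- give (df/f) ∧ θ³ = df ∧ ω.
      · have h1 := OneForm.extD_smul (hfs y) (hωs y) v w
        refine h1.trans ?_
        have hω : ∀ u : F, (ωA y : F →L[ℝ] ℝ) u = T 2 u / f y := fun u =>
          (eq_div_iff (hf_pos y).ne').2 (by rw [mul_comm]; rfl)
        have hdfu : ∀ u : F, (OneForm.differential f y : F →L[ℝ] ℝ) u =
          f₁ y * T 0 u + f₂ y * T 1 u := fun u => hf12 y hy u
        have hcu : ωA.extD y v w = c y * (T 0 v * T 1 w - T 0 w * T 1 v) := hc y hy v w
        simp only [Fin.sum_univ_three, OneForm.wedge]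
        have key : ∀ q d₀ d₁ o₀ o₁ z₀ z₁ z₂ w₀ w₁ w₂ a b m n : ℝ, q = a * (z₀ * w₁ - w₀ * z₁) → d₀ = m * z₀ + n * z₁ → d₁ = m * w₀ + n * w₁ →
            o₀ = z₂ / b → o₁ = w₂ / b →
            b * q + (d₀ * o₁ - d₁ * o₀) =
              -((-(-(b * a / 2 * z₁) - m / b * z₂) * w₀ - -(-(b * a / 2 * w₁) - m / b * w₂) * z₀) +
                (-(b * a / 2 * z₀ - n / b * z₂) * w₁ - -(b * a / 2 * w₀ - n / b * w₂) * z₁) +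
                (0 * w₂ - 0 * z₂)) := by
          intros
          subst_vars
          ring
        exact key _ _ _ _ _ (T 0 v) (T 1 v) (T 2 v) (T 0 w) (T 1 w) (T 2 w) (c y) (f y) (f₁ y)
          (f₂ y) hcu (hdfu v) (hdfu w) (hω v) (hω w)
  refine ⟨Θ, hΘ, fun Θ' hΘ' i j y hy => hΘ.unique hF hΘ' hy (fun i j => hdual i j y hy) i j,
    fun cov hcov j y hy v => hΘ.cov_eq hF hW hθs hdual hmetric hcov j hy v,
    fun y hy => ⟨rfl, ?_, rfl⟩⟩
  -- The stated formula negates the scalar, whereas `B` negates the form.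
  have key : ∀ (a r : ℝ) (x z : F →L[ℝ] ℝ), -(a • x) - r • z = -a • x - r • z := by
    intro a r x z
    ext u
    simp
  exact key (k y) (r₁ y) (θ 1 y) (θ 2 y)
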